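/- Let $\psi\colon(0,\infty)\to(0,\infty)$ be a nonincreasing function with $\lim_{x\to+\infty}\psi(x)=0$, and let \[ \lambda(\psi)=\liminf_{x\to\infty}\frac{-\log\psi(x)}{\log x}\in[0,\infty] \] be its lower order. Let $\mathfrak F^*=\{x+iy\colon x,y\in[-1/2,1/2)\}\setminus\{0\}$ and \[ W(\psi)=\bigl\{z\in\mathfrak F^*\colon |z-p/q|\le\psi(|q|)\ \text{for infinitely many pairs } (p,q)\in\mathbb Z[i]\times\mathbb Z[i] \text{ with } q\ne0\bigr\}. \] Then, with the conventions $4/0=\infty$ and $4/\infty=0$, \[ \dim_{\mathrm H} W(\psi)=\min\bigl(4/\lambda(\psi),2\bigr)\quad\text{and}\quad \dim_{\mathrm P} W(\psi)=2, \] where $\dim_{\mathrm H}$ and $\dim_{\mathrm P}$ denote the Hausdorff and the packing dimension in $\mathbb C$ with the Euclidean metric. -/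

import Mathlib

open Filter Topology Set
open scoped ENNReal NNReal

noncomputable section

/-! ### Packing dimension -/

/-- `P` (a set of pairs centre, radius) is a `δ`-packing of `E`: a countable family of pairwise
disjoint closed balls with centres in `E` and positive radii at most `δ`. -/
def IsBallPacking {X : Type*} [MetricSpace X] (δ : ℝ) (E : Set X) (P : Set (X × ℝ)) : Prop :=
  P.Countable ∧ (∀ b ∈ P, b.1 ∈ E ∧ 0 < b.2 ∧ b.2 ≤ δ) ∧
    P.PairwiseDisjoint fun b => Metric.closedBall b.1 b.2

/-- The packing premeasure `𝒫₀ˢ(E) = lim_{δ → 0} sup ∑ᵢ (2 rᵢ)ˢ`, the supremum over all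
`δ`-packings of `E` by balls of radii `rᵢ`; the limit is an infimum, since the supremum decreases
with `δ`. -/
def packingPremeasure {X : Type*} [MetricSpace X] (s : ℝ≥0) (E : Set X) : ℝ≥0∞ :=
  ⨅ (δ : ℝ) (_ : 0 < δ), ⨆ (P : Set (X × ℝ)) (_ : IsBallPacking δ E P),
    ∑' b : P, ENNReal.ofReal (2 * b.1.2) ^ (s : ℝ)

/-- The `s`-dimensional packing measure
`𝒫ˢ(E) = inf {∑ᵢ 𝒫₀ˢ(Eᵢ) : E ⊆ ⋃ᵢ Eᵢ}`, over countable covers by arbitrary sets. -/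
def packingMeasure {X : Type*} [MetricSpace X] (s : ℝ≥0) (E : Set X) : ℝ≥0∞ :=
  ⨅ (F : ℕ → Set X) (_ : E ⊆ ⋃ i, F i), ∑' i, packingPremeasure s (F i)

/-- The packing dimension `sup {s : 𝒫ˢ(E) = ∞}`. -/
def packingDim {X : Type*} [MetricSpace X] (E : Set X) : ℝ≥0∞ :=
  ⨆ (s : ℝ≥0) (_ : packingMeasure s E = ∞), (s : ℝ≥0∞)

/-! ### Approximation by Gaussian rationals -/

/-- The Hurwitz domain `{x + iy : x, y ∈ [-1/2, 1/2)}`. -/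
def hurwitzDomain : Set ℂ :=
  {z | z.re ∈ Ico (-1 / 2 : ℝ) (1 / 2) ∧ z.im ∈ Ico (-1 / 2 : ℝ) (1 / 2)}

/-- The set `W(ψ)` of nonzero `z` in the Hurwitz domain with `|z - p/q| ≤ ψ(|q|)` for infinitely
many pairs `(p, q)` of Gaussian integers, `q ≠ 0`. -/
def approximableSet (ψ : ℝ → ℝ) : Set ℂ :=
  {z | z ∈ hurwitzDomain \ {0} ∧
    {pq : GaussianInt × GaussianInt | pq.2 ≠ 0 ∧
      ‖z - (pq.1 : ℂ) / (pq.2 : ℂ)‖ ≤ ψ ‖(pq.2 : ℂ)‖}.Infinite}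

/-- The lower order `λ(ψ) = liminf_{x → ∞} (-log ψ(x)) / log x`, an extended real number. -/
def lowerOrder (ψ : ℝ → ℝ) : EReal :=
  liminf (fun x : ℝ => ((-Real.log (ψ x) / Real.log x : ℝ) : EReal)) atTop

/-- The lower order is nonnegative for the functions considered, so that passing to `ℝ≥0∞` by
`EReal.toENNReal` loses nothing. -/
theorem lowerOrder_nonneg (ψ : ℝ → ℝ) (hpos : ∀ x, 0 < x → 0 < ψ x)
    (hlim : Tendsto ψ atTop (𝓝 0)) : 0 ≤ lowerOrder ψ := by
  refine le_liminf_of_le (by isBoundedDefault) ?_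
  filter_upwards [hlim.eventually (gt_mem_nhds zero_lt_one), eventually_gt_atTop (1 : ℝ)]
    with x h1 hx
  have h2 := Real.log_nonpos (hpos x (by linarith)).le h1.le
  exact_mod_cast div_nonneg (by linarith) (Real.log_nonneg hx.le)

end

/-! Write λ for the lower order. For l < λ, ψ(x) ≤ x⁻ˡ eventually, so W(ψ) lies in the limsup set of
discs of radius |q|⁻ˡ about fractions p/q with |p| ≤ 2|q|. The sum of their s-th powers is
controlled by a lattice sum over ℤ⁴ with exponent ls, finite once ls > 4. Hausdorff–Cantelli gives
dim_H ≤ 4/λ.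

For s < min(4/λ, 2), pick l between max(λ, 2) and 4/s. There are arbitrarily large Q with Q⁻ˡ ≤
ψ(Q). Dirichlet's theorem and an area count (`exists_finset_gaussianRat`) put at least a constant
times ρ²Q⁴ fractions with |q| ≤ Q in any disc of radius ρ, once Q is large. These are 1/Q² apart
(`one_div_sq_le_dist_gaussianRat`), and l > 2 keeps their discs of radius Q⁻ˡ apart. Iterating gives
a Cantor set inside W(ψ), because ψ(|q|) ≥ ψ(Q). Its uniform measure satisfies μ(A) ≤ C (diam A)ˢ,
since ls < 4 lets Q outweigh all earlier losses (`le_dimH_of_tree`).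

For packing dimension, W(ψ) contains the trace of a dense Gδ on a disc. By Baire, in any countable
cover some piece is dense in a smaller disc, where packings see the full dimension 2
(`two_le_packingDim`); area gives the upper bound. -/

open MeasureTheory Metric

/-! ### Upper bound for the Hausdorff dimension -/

/-- **Hausdorff–Cantelli lemma.** The points lying in infinitely many members of a countable family
of sets form a null set for `μH[s]` when the sum of the `s`-th powers of the diameters is finite. -/
theorem hausdorffMeasure_setOf_infinite_eq_zero {X ι : Type*} [EMetricSpace X] [MeasurableSpace X]
    [BorelSpace X] [Countable ι] {s : ℝ} (hs : 0 < s) (U : ι → Set X)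
    (hU : ∑' i, ediam (U i) ^ s ≠ ∞) : μH[s] {x | {i | x ∈ U i}.Infinite} = 0 := by
  have hlim : Tendsto (fun F : Finset ι => ∑' i : {i // i ∉ F}, ediam (U i) ^ s) atTop (𝓝 0) :=
    ENNReal.tendsto_tsum_compl_atTop_zero hU
  have hle := Measure.hausdorffMeasure_le_liminf_tsum (ι := fun F : Finset ι => {i // i ∉ F}) s
    {x | {i | x ∈ U i}.Infinite} (l := atTop)
    (fun F : Finset ι => (∑' i : {i // i ∉ F}, ediam (U i) ^ s) ^ (1 / s))
    (by
      have := hlim.ennrpow_const (1 / s)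
      rwa [ENNReal.zero_rpow_of_pos (by positivity)] at this)
    (fun F i => U i)
    (Eventually.of_forall fun F i => by
      rw [one_div, ENNReal.le_rpow_inv_iff hs]
      exact ENNReal.le_tsum (f := fun i : {i // i ∉ F} => ediam (U i) ^ s) i)
    (Eventually.of_forall fun F x hx => by
      obtain ⟨i, hi, hiF⟩ := hx.exists_notMem_finset F
      exact mem_iUnion.2 ⟨⟨i, hiF⟩, hi⟩)
  rw [hlim.liminf_eq] at hle
  exact le_antisymm hle bot_le

theorem GaussianInt.one_le_norm_toComplex {q : GaussianInt} (hq : q ≠ 0) : 1 ≤ ‖(q : ℂ)‖ := by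
  have h1 : (1 : ℤ) ≤ q.norm := GaussianInt.norm_pos.2 hq
  have h2 : (1 : ℝ) ≤ Complex.normSq (q : ℂ) := by
    rw [← GaussianInt.intCast_real_norm]; exact_mod_cast h1
  rw [Complex.normSq_eq_norm_sq] at h2
  nlinarith [_root_.norm_nonneg (q : ℂ)]

instance : Countable GaussianInt :=
  (show Function.Injective fun z : GaussianInt => (z.re, z.im) from fun a b h => by
    simp only [Prod.mk.injEq] at h
    exact Zsqrtd.ext h.1 h.2).countable

/-- The vector of coordinates of a pair of Gaussian integers. -/
def gaussianPairCoords (z : GaussianInt × GaussianInt) : Fin 4 → ℝ :=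
  ![z.1.re, z.1.im, z.2.re, z.2.im]

theorem gaussianPairCoords_injective : Function.Injective gaussianPairCoords := by
  rintro ⟨⟨a, b⟩, ⟨c, d⟩⟩ ⟨⟨a', b'⟩, ⟨c', d'⟩⟩ h
  have h0 := congrFun h 0
  have h1 := congrFun h 1
  have h2 := congrFun h 2
  have h3 := congrFun h 3
  simp only [gaussianPairCoords, Matrix.cons_val, Int.cast_inj] at h0 h1 h2 h3
  subst h0 h1 h2 h3
  rfl

theorem norm_gaussianPairCoords_le (z : GaussianInt × GaussianInt) :
    ‖gaussianPairCoords z‖ ≤ max ‖(z.1 : ℂ)‖ ‖(z.2 : ℂ)‖ := by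
  rw [pi_norm_le_iff_of_nonneg (by positivity)]
  have h1 := Complex.abs_re_le_norm (z.1 : ℂ)
  have h2 := Complex.abs_im_le_norm (z.1 : ℂ)
  have h3 := Complex.abs_re_le_norm (z.2 : ℂ)
  have h4 := Complex.abs_im_le_norm (z.2 : ℂ)
  intro i
  fin_cases i <;> simp [gaussianPairCoords] <;> tauto

/-- The coordinate vectors lie in ℤ⁴, and a lattice sum of norms converges as soon as the exponent
exceeds the rank. -/
theorem summable_norm_gaussianPairCoords_rpow {t : ℝ} (ht : 4 < t) :
    Summable fun z : GaussianInt × GaussianInt => ‖gaussianPairCoords z‖ ^ (-t) := by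
  let L : Submodule ℤ (Fin 4 → ℝ) := Submodule.span ℤ (range (Pi.basisFun ℝ (Fin 4)))
  have hrank : Module.finrank ℤ L ≤ 4 :=
    (finrank_range_le_card (R := ℤ) (Pi.basisFun ℝ (Fin 4))).trans_eq (Fintype.card_fin 4)
  have hmem (z : GaussianInt × GaussianInt) : gaussianPairCoords z ∈ L := by
    rw [(Pi.basisFun ℝ (Fin 4)).mem_span_iff_repr_mem ℤ]
    intro i
    fin_cases i
    exacts [⟨z.1.re, by simp [gaussianPairCoords]⟩, ⟨z.1.im, by simp [gaussianPairCoords]⟩,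
      ⟨z.2.re, by simp [gaussianPairCoords]⟩, ⟨z.2.im, by simp [gaussianPairCoords]⟩]
  have hsum := ZLattice.summable_norm_rpow L (-t) (by
    have : (Module.finrank ℤ L : ℝ) ≤ 4 := by exact_mod_cast hrank
    linarith)
  exact hsum.comp_injective (i := fun z => (⟨gaussianPairCoords z, hmem z⟩ : L))
    fun a b h => gaussianPairCoords_injective (congrArg Subtype.val h)

theorem norm_le_one_of_mem_hurwitzDomain {z : ℂ} (hz : z ∈ hurwitzDomain) : ‖z‖ ≤ 1 := by
  obtain ⟨⟨h1, h2⟩, h3, h4⟩ := hz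
  refine (Complex.norm_le_abs_re_add_abs_im z).trans ?_
  have : |z.re| ≤ 1 / 2 := abs_le.2 ⟨by linarith, by linarith⟩
  have : |z.im| ≤ 1 / 2 := abs_le.2 ⟨by linarith, by linarith⟩
  linarith

/-- The Gaussian rationals with a numerator bounded in terms of the denominator, thickened
according to a power law. -/
def powerLawDisc (l : ℝ) (pq : GaussianInt × GaussianInt) : Set ℂ :=
  {z | pq.2 ≠ 0 ∧ ‖(pq.1 : ℂ)‖ ≤ 2 * ‖(pq.2 : ℂ)‖ ∧
    z ∈ closedBall ((pq.1 : ℂ) / (pq.2 : ℂ)) (‖(pq.2 : ℂ)‖ ^ (-l))}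

/-- The condition |p| ≤ 2|q| bounds the coordinate vector by 2|q|, so a power of |q| alone turns
into a summable function of the pair. Without that condition the disc is empty. -/
theorem ediam_powerLawDisc_rpow_le {l s : ℝ} (hl : 0 < l) (hs : 0 < s)
    (pq : GaussianInt × GaussianInt) :
    ediam (powerLawDisc l pq) ^ s ≤
      ENNReal.ofReal (2 ^ s * 2 ^ (l * s) * ‖gaussianPairCoords pq‖ ^ (-(l * s))) := by
  by_cases h : pq.2 ≠ 0 ∧ ‖(pq.1 : ℂ)‖ ≤ 2 * ‖(pq.2 : ℂ)‖
  · have hq := GaussianInt.one_le_norm_toComplex h.1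
    have hsub : powerLawDisc l pq ⊆
        closedBall ((pq.1 : ℂ) / (pq.2 : ℂ)) (‖(pq.2 : ℂ)‖ ^ (-l)) := fun z hz => hz.2.2
    have h0 : (0 : ℝ) ≤ ‖(pq.2 : ℂ)‖ ^ (-l) := by positivity
    have h1 : ediam (powerLawDisc l pq) ≤ ENNReal.ofReal (2 * ‖(pq.2 : ℂ)‖ ^ (-l)) := by
      refine ediam_le fun x hx y hy => ?_
      rw [edist_dist]
      apply ENNReal.ofReal_le_ofReal
      have hx' := mem_closedBall.1 (hsub hx)
      have hy' := mem_closedBall.1 (hsub hy)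
      linarith [dist_triangle_right x y ((pq.1 : ℂ) / (pq.2 : ℂ))]
    refine (ENNReal.rpow_le_rpow h1 hs.le).trans ?_
    rw [ENNReal.ofReal_rpow_of_nonneg (by positivity) hs.le]
    apply ENNReal.ofReal_le_ofReal
    rw [Real.mul_rpow (by norm_num) h0, ← Real.rpow_mul (by positivity), mul_assoc]
    gcongr
    have hpos : 0 < ‖gaussianPairCoords pq‖ := by
      rw [norm_pos_iff]
      intro h0
      have : gaussianPairCoords pq = gaussianPairCoords (0, 0) := by
        rw [h0]; ext i; fin_cases i <;> simp [gaussianPairCoords]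
      exact h.1 (congrArg Prod.snd (gaussianPairCoords_injective this))
    have hle : ‖gaussianPairCoords pq‖ ≤ 2 * ‖(pq.2 : ℂ)‖ :=
      (norm_gaussianPairCoords_le pq).trans (max_le h.2 (by linarith))
    calc ‖(pq.2 : ℂ)‖ ^ (-l * s) ≤ (‖gaussianPairCoords pq‖ / 2) ^ (-l * s) :=
          Real.rpow_le_rpow_of_nonpos (by positivity) (by linarith) (by nlinarith)
      _ = 2 ^ (l * s) * ‖gaussianPairCoords pq‖ ^ (-(l * s)) := by
          rw [Real.div_rpow (by positivity) (by norm_num), neg_mul, Real.rpow_neg (x := 2)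
            (by norm_num)]
          field_simp
  · have : powerLawDisc l pq = ∅ := by
      ext z; simp only [powerLawDisc, mem_ofPred_eq, mem_empty_iff_false, iff_false]; tauto
    rw [this, ediam_empty, ENNReal.zero_rpow_of_pos hs]
    exact bot_le

/-- A bounded region contains finitely many Gaussian integers. -/
theorem finite_setOf_norm_toComplex_le (R : ℝ) : {q : GaussianInt | ‖(q : ℂ)‖ ≤ R}.Finite := by
  refine (((finite_Icc (-⌈R⌉) ⌈R⌉).prod (finite_Icc (-⌈R⌉) ⌈R⌉)).preimage
    (f := fun z : GaussianInt => (z.re, z.im)) ?_).subset ?_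
  · intro a _ b _ h
    simp only [Prod.mk.injEq] at h
    exact Zsqrtd.ext h.1 h.2
  · intro q hq
    have key (a : ℤ) (h : |(a : ℝ)| ≤ R) : a ∈ Icc (-⌈R⌉) ⌈R⌉ := by
      have := abs_le.1 (h.trans (Int.le_ceil R))
      constructor <;> [have := this.1; have := this.2] <;> exact_mod_cast this
    have h1 := (Complex.abs_re_le_norm (q : ℂ)).trans hq
    have h2 := (Complex.abs_im_le_norm (q : ℂ)).trans hq
    rw [← GaussianInt.intCast_re] at h1
    rw [← GaussianInt.intCast_im] at h2
    exact ⟨key _ h1, key _ h2⟩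

theorem norm_le_of_norm_sub_div_le {z p q : ℂ} (hq : q ≠ 0) {B : ℝ}
    (h : ‖z - p / q‖ ≤ B) : ‖p‖ ≤ (‖z‖ + B) * ‖q‖ := by
  have h1 : p = p / q * q := by field_simp
  have h2 : ‖p / q‖ ≤ ‖z‖ + B := by
    calc ‖p / q‖ = ‖z - (z - p / q)‖ := by congr 1; ring
      _ ≤ ‖z‖ + ‖z - p / q‖ := norm_sub_le _ _
      _ ≤ _ := by linarith
  calc ‖p‖ = ‖p / q‖ * ‖q‖ := by rw [← norm_mul, ← h1]
    _ ≤ _ := by gcongr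

theorem dimH_approximableSet_le_of_eventually {ψ : ℝ → ℝ} (hanti : AntitoneOn ψ (Ioi 0))
    {l : ℝ} {s : ℝ≥0} (hl : 0 < l)
    (hs : 0 < s) (hls : 4 < l * s) (hψ : ∀ᶠ x in atTop, ψ x ≤ x ^ (-l)) :
    dimH (approximableSet ψ) ≤ s := by
  have hs' : (0 : ℝ) < s := hs
  have hnull : μH[(s : ℝ)] {x | {i | x ∈ powerLawDisc l i}.Infinite} = 0 := by
    refine hausdorffMeasure_setOf_infinite_eq_zero hs' _ (ne_of_lt ?_)
    refine (ENNReal.tsum_le_tsum fun i => ediam_powerLawDisc_rpow_le hl hs' i).trans_lt ?_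
    have hsum := (summable_norm_gaussianPairCoords_rpow hls).mul_left
      ((2 : ℝ) ^ (s : ℝ) * 2 ^ (l * s))
    rw [← ENNReal.ofReal_tsum_of_nonneg (fun i => by positivity) hsum]
    exact ENNReal.ofReal_lt_top
  refine dimH_le_of_hausdorffMeasure_ne_top (d := s) (ne_of_lt ?_)
  refine (measure_mono (t := {x | {i | x ∈ powerLawDisc l i}.Infinite}) ?_).trans_lt
    (hnull ▸ ENNReal.zero_lt_top)
  obtain ⟨X, hX⟩ := eventually_atTop.1 hψ
  rintro z ⟨hz, hinf⟩
  have hz1 := norm_le_one_of_mem_hurwitzDomain hz.1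
  -- The pairs with |q| ≤ X, where the power law may fail, are negligible: |z| ≤ 1 and ψ(|q|) ≤ ψ(1)
  -- bound their numerators.
  have hfin : {pq : GaussianInt × GaussianInt | ‖(pq.1 : ℂ)‖ ≤ (1 + ψ 1) * X ∧
      ‖(pq.2 : ℂ)‖ ≤ X}.Finite :=
    (finite_setOf_norm_toComplex_le ((1 + ψ 1) * X)).prod (finite_setOf_norm_toComplex_le X)
  refine (hinf.sdiff hfin).mono ?_
  rintro ⟨p, q⟩ ⟨⟨hq, hle⟩, hnot⟩
  have hq1 := GaussianInt.one_le_norm_toComplex hq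
  have hqc : (q : ℂ) ≠ 0 := by simpa using hq
  simp only at hle hq
  have hXq : X ≤ ‖(q : ℂ)‖ := by
    by_contra! hlt
    apply hnot
    refine ⟨?_, hlt.le⟩
    have hψ1 : ψ ‖(q : ℂ)‖ ≤ ψ 1 := hanti (mem_Ioi.2 one_pos) (mem_Ioi.2 (by linarith)) hq1
    have h0 : 0 ≤ ψ 1 := (norm_nonneg _).trans (hle.trans hψ1)
    refine (norm_le_of_norm_sub_div_le hqc (hle.trans hψ1)).trans ?_
    gcongr
  have h2 := hle.trans (hX _ hXq)
  refine ⟨hq, ?_, ?_⟩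
  · have h3 : ‖(q : ℂ)‖ ^ (-l) ≤ 1 := Real.rpow_le_one_of_one_le_of_nonpos hq1 (by linarith)
    refine (norm_le_of_norm_sub_div_le hqc (h2.trans h3)).trans ?_
    dsimp only
    gcongr
    linarith
  · rwa [mem_closedBall, dist_eq_norm]

/-- For s > 4/λ there is an l with 4/s < l < λ; being below the liminf, l is an eventual exponent
for ψ. -/
theorem dimH_approximableSet_le {ψ : ℝ → ℝ} (hpos : ∀ x, 0 < x → 0 < ψ x)
    (hanti : AntitoneOn ψ (Ioi 0)) :
    dimH (approximableSet ψ) ≤ 4 / (lowerOrder ψ).toENNReal := by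
  refine le_of_forall_gt fun c hc => ?_
  obtain ⟨s, hs1, hs2⟩ := ENNReal.lt_iff_exists_nnreal_btwn.1 hc
  refine lt_of_le_of_lt ?_ hs2
  have hs0 : 0 < s := by
    have := (zero_le (a := 4 / (lowerOrder ψ).toENNReal)).trans_lt hs1
    exact_mod_cast this
  have hlt : 4 / (s : ℝ≥0∞) < (lowerOrder ψ).toENNReal := by
    rw [ENNReal.div_lt_iff (by simp) (by simp)] at hs1
    rwa [ENNReal.div_lt_iff (by simp) (by simp), mul_comm]
  obtain ⟨l, hl1, hl2⟩ := ENNReal.lt_iff_exists_nnreal_btwn.1 hlt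
  have hl3 : ((l : ℝ) : EReal) < lowerOrder ψ := by
    by_contra! h
    have := EReal.toENNReal_le_toENNReal h
    rw [EReal.real_coe_toENNReal, ENNReal.ofReal_coe_nnreal] at this
    exact this.not_gt hl2
  have hls : 4 < (l : ℝ) * s := by
    rw [ENNReal.div_lt_iff (by simp [hs0.ne']) (by simp)] at hl1
    exact_mod_cast hl1
  have hl0 : 0 < (l : ℝ) := by
    have : (0 : ℝ) < s := hs0
    by_contra! h
    nlinarith
  refine dimH_approximableSet_le_of_eventually hanti hl0 hs0 hls ?_
  filter_upwards [eventually_lt_of_lt_liminf hl3 (by isBoundedDefault), eventually_gt_atTop 1]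
    with x hx hx1
  have hx2 : (l : ℝ) < -Real.log (ψ x) / Real.log x := by exact_mod_cast hx
  rw [lt_div_iff₀ (Real.log_pos hx1)] at hx2
  rw [← Real.log_le_log_iff (hpos x (by linarith)) (by positivity), Real.log_rpow (by linarith)]
  linarith

/-! ### Area bounds for disjoint discs -/

theorem tsum_ofReal_sq_le_of_disjoint_ball {ι : Type*} [Countable ι] {c : ι → ℂ} {r : ι → ℝ}
    {x : ℂ} {R : ℝ} (hd : Pairwise (Function.onFun Disjoint fun i => ball (c i) (r i)))
    (hsub : ∀ i, ball (c i) (r i) ⊆ ball x R) :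
    ∑' i, ENNReal.ofReal (r i) ^ 2 ≤ ENNReal.ofReal R ^ 2 := by
  have h1 : ∑' i, volume (ball (c i) (r i)) ≤ volume (ball x R) :=
    (tsum_meas_le_meas_iUnion_of_disjoint volume (fun i => measurableSet_ball) hd).trans
      (measure_mono (iUnion_subset hsub))
  simp only [Complex.volume_ball, ENNReal.tsum_mul_right] at h1
  have hpi : (NNReal.pi : ℝ≥0∞) ≠ 0 := by
    simpa using NNReal.pi_ne_zero
  exact (ENNReal.mul_le_mul_iff_left hpi ENNReal.coe_ne_top).1 h1

/-- A `δ`-separated family in a disc of radius `R` has at most `(2R/δ + 1)²` members. -/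
theorem card_mul_sq_le_of_separated {ι : Type*} (F : Finset ι) {c : ι → ℂ} {δ R : ℝ} {x : ℂ}
    (hδ : 0 < δ) (hR : 0 ≤ R) (hsep : ∀ i ∈ F, ∀ j ∈ F, i ≠ j → δ ≤ dist (c i) (c j))
    (hmem : ∀ i ∈ F, dist (c i) x ≤ R) : (F.card : ℝ) * δ ^ 2 ≤ (2 * R + δ) ^ 2 := by
  have h := tsum_ofReal_sq_le_of_disjoint_ball (ι := F) (c := fun i => c i) (r := fun _ => δ / 2)
    (x := x) (R := R + δ / 2)
    (fun i j hij => ball_disjoint_ball (by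
      have := hsep i i.2 j j.2 (fun h => hij (Subtype.ext h))
      linarith))
    (fun i => ball_subset_ball' (by linarith [hmem i i.2]))
  rw [tsum_fintype, Finset.sum_const, Finset.card_univ, Fintype.card_coe, nsmul_eq_mul,
    ← ENNReal.ofReal_pow (by positivity), ← ENNReal.ofReal_pow (by positivity),
    ← ENNReal.ofReal_natCast, ← ENNReal.ofReal_mul (by positivity),
    ENNReal.ofReal_le_ofReal_iff (by positivity)] at h
  nlinarith

/-! ### Packing dimension: area from above, Baire category from below -/

theorem packingPremeasure_empty {X : Type*} [MetricSpace X] (s : ℝ≥0) :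
    packingPremeasure s (∅ : Set X) = 0 := by
  refine le_antisymm (iInf₂_le_of_le 1 one_pos (iSup₂_le fun P hP => ?_)) bot_le
  have : P = ∅ := eq_empty_of_forall_notMem fun b hb => (hP.2.1 b hb).1
  subst this
  simp

theorem packingMeasure_le_packingPremeasure {X : Type*} [MetricSpace X] (s : ℝ≥0) (E : Set X) :
    packingMeasure s E ≤ packingPremeasure s E := by
  refine iInf₂_le_of_le (fun i => if i = 0 then E else ∅)
    (fun x hx => mem_iUnion.2 ⟨0, by simpa using hx⟩) ?_
  rw [tsum_eq_single 0 fun i hi => by simp [hi, packingPremeasure_empty]]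
  simp

theorem packingPremeasure_ne_top_of_bounded {E : Set ℂ} {R : ℝ} (hE : E ⊆ closedBall 0 R)
    {s : ℝ≥0} (hs : 2 ≤ s) : packingPremeasure s E ≠ ∞ := by
  have hle : packingPremeasure s E ≤ 2 ^ 2 * ENNReal.ofReal (R + 1) ^ 2 := by
    -- With radii at most 1/2, diameters are at most 1, so passing from exponent s ≥ 2 to 2 only
    -- increases the sum; the discs stay within radius R + 1.
    refine iInf₂_le_of_le (1 / 2) (by norm_num) (iSup₂_le fun P ⟨hcount, hP, hdisj⟩ => ?_)
    have := hcount.to_subtype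
    have hsum := tsum_ofReal_sq_le_of_disjoint_ball (ι := P) (c := fun b => b.1.1)
      (r := fun b => b.1.2) (x := 0) (R := R + 1)
      (fun b b' hbb => (hdisj b.2 b'.2 fun h => hbb (Subtype.ext h)).mono ball_subset_closedBall
        ball_subset_closedBall)
      (fun b => ball_subset_ball' (by
        have := mem_closedBall.1 (hE (hP b b.2).1)
        linarith [(hP b b.2).2.2]))
    refine le_trans ?_ (mul_le_mul_right hsum (2 ^ 2))
    rw [← ENNReal.tsum_mul_left]
    refine ENNReal.tsum_le_tsum fun b => ?_
    have hb := (hP b b.2).2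
    calc ENNReal.ofReal (2 * b.1.2) ^ (s : ℝ) ≤ ENNReal.ofReal (2 * b.1.2) ^ (2 : ℝ) :=
          ENNReal.rpow_le_rpow_of_exponent_ge
            (by rw [← ENNReal.ofReal_one]; exact ENNReal.ofReal_le_ofReal (by linarith))
            (by exact_mod_cast hs)
      _ = 2 ^ 2 * ENNReal.ofReal b.1.2 ^ 2 := by
          rw [ENNReal.ofReal_mul (by norm_num), ← mul_pow]
          norm_num
  exact ne_top_of_le_ne_top
    (ENNReal.mul_ne_top (by simp) (ENNReal.pow_ne_top ENNReal.ofReal_ne_top)) hle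

/-- The upper bound for the packing dimension of a bounded plane set. -/
theorem packingDim_le_two_of_bounded {E : Set ℂ} {R : ℝ} (hE : E ⊆ closedBall 0 R) :
    packingDim E ≤ 2 := by
  refine iSup₂_le fun s hs => ?_
  by_contra! h
  have h2 : (2 : ℝ≥0) < s := by exact_mod_cast h
  exact packingPremeasure_ne_top_of_bounded hE h2.le
    (top_le_iff.1 (hs ▸ packingMeasure_le_packingPremeasure s E))

/-- A set that is dense in a disc has packings by many balls of comparable radii. -/
theorem exists_isBallPacking_of_ball_subset_closure {F : Set ℂ} {x : ℂ} {r δ : ℝ} (hr : 0 < r)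
    (hF : ball x r ⊆ closure F) {m : ℕ} (hm : 0 < m) (hδ : r / (16 * m) ≤ δ) (s : ℝ≥0) :
    ∃ P, IsBallPacking δ F P ∧ ∑' b : P, ENNReal.ofReal (2 * b.1.2) ^ (s : ℝ) =
      ENNReal.ofReal ((r / 8) ^ (s : ℝ) * (m : ℝ) ^ (2 - s : ℝ)) := by
  have hm' : (0 : ℝ) < m := by exact_mod_cast hm
  -- An m × m grid of this mesh stays within r/2 of `x`. Moving its points into `F` by less than h/8
  -- keeps them more than 3h/4 apart, so discs of radius h/4 = r/(16m) are disjoint.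
  set h : ℝ := r / (4 * m) with hh
  have hpos : 0 < h := by positivity
  let γ : Fin m × Fin m → GaussianInt := fun a => ⟨a.1, a.2⟩
  let g : Fin m × Fin m → ℂ := fun a => x + h * (γ a : ℂ)
  have hγ : Function.Injective γ := by
    rintro ⟨a, b⟩ ⟨a', b'⟩ hab
    simp only [γ, Zsqrtd.mk.injEq, Nat.cast_inj, Fin.val_inj] at hab
    exact Prod.ext hab.1 hab.2
  have hg (a : Fin m × Fin m) : g a ∈ ball x r := by
    have h1 : ((a.1 : ℕ) : ℝ) < m := by exact_mod_cast a.1.2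
    have h2 : ((a.2 : ℕ) : ℝ) < m := by exact_mod_cast a.2.2
    have h3 : ‖(γ a : ℂ)‖ ≤ 2 * m := by
      refine (Complex.norm_le_abs_re_add_abs_im _).trans ?_
      simp only [γ, GaussianInt.re_toComplex, GaussianInt.im_toComplex, Int.cast_natCast,
        Nat.abs_cast]
      linarith
    rw [mem_ball, dist_eq_norm]
    simp only [g, add_sub_cancel_left, norm_mul, Complex.norm_real, Real.norm_eq_abs,
      abs_of_pos hpos]
    calc h * ‖(γ a : ℂ)‖ ≤ h * (2 * m) := by gcongr
      _ = r / 2 := by rw [hh]; field_simp; norm_num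
      _ < r := by linarith
  have hsep (a b : Fin m × Fin m) (hab : a ≠ b) : h ≤ dist (g a) (g b) := by
    have h1 := GaussianInt.one_le_norm_toComplex (sub_ne_zero.2 (hγ.ne hab))
    rw [dist_eq_norm]
    simp only [g, add_sub_add_left_eq_sub, ← mul_sub, norm_mul, Complex.norm_real,
      Real.norm_eq_abs, abs_of_pos hpos, ← GaussianInt.toComplex_sub]
    nlinarith
  have hex (a : Fin m × Fin m) : ∃ f ∈ F, dist (g a) f < h / 8 :=
    Metric.mem_closure_iff.1 (hF (hg a)) (h / 8) (by positivity)
  choose f hfF hfg using hex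
  have hfsep (a b : Fin m × Fin m) (hab : a ≠ b) : h / 4 + h / 4 < dist (f a) (f b) := by
    have h1 := hsep a b hab
    have h2 := hfg a
    have h3 := hfg b
    have h4 := dist_triangle4 (g a) (f a) (f b) (g b)
    rw [dist_comm (f b)] at h4
    linarith
  let b : Fin m × Fin m → ℂ × ℝ := fun a => (f a, h / 4)
  have hinj : Function.Injective b := by
    intro a a' haa
    by_contra hne
    have h1 := hfsep a a' hne
    have h2 : f a = f a' := congrArg Prod.fst haa
    rw [h2, dist_self] at h1
    linarith
  refine ⟨range b, ⟨(finite_range b).countable, ?_, ?_⟩, ?_⟩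
  · rintro _ ⟨a, rfl⟩
    refine ⟨hfF a, by positivity, le_trans (le_of_eq ?_) hδ⟩
    simp only [b, hh]
    field_simp
    norm_num
  · rintro _ ⟨a, rfl⟩ _ ⟨a', rfl⟩ hne
    exact closedBall_disjoint_closedBall (hfsep a a' fun h => hne (by rw [h]))
  · rw [tsum_range (fun c : ℂ × ℝ => ENNReal.ofReal (2 * c.2) ^ (s : ℝ)) hinj]
    simp only [b, tsum_fintype, Finset.sum_const, Finset.card_univ, Fintype.card_prod,
      Fintype.card_fin, nsmul_eq_mul]
    rw [ENNReal.ofReal_rpow_of_nonneg (by positivity) s.coe_nonneg, ← ENNReal.ofReal_natCast,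
      ← ENNReal.ofReal_mul (by positivity)]
    congr 1
    have h1 : 2 * (h / 4) = (r / 8) / m := by rw [hh]; field_simp; norm_num
    rw [h1, Real.div_rpow (by positivity) hm'.le, Real.rpow_sub hm', Nat.cast_mul]
    norm_num
    field_simp

/-- A packing by m² discs of diameter of order 1/m has sum of order m^(2 - s), which is unbounded at
every scale δ. -/
theorem packingPremeasure_eq_top_of_ball_subset_closure {F : Set ℂ} {x : ℂ} {r : ℝ} (hr : 0 < r)
    (hF : ball x r ⊆ closure F) {s : ℝ≥0} (hs : s < 2) : packingPremeasure s F = ∞ := by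
  have hs' : (s : ℝ) < 2 := by exact_mod_cast hs
  refine iInf₂_eq_top.2 fun δ hδ => top_le_iff.1 ?_
  have hlim : Tendsto (fun m : ℕ => ENNReal.ofReal ((r / 8) ^ (s : ℝ) * (m : ℝ) ^ (2 - s : ℝ)))
      atTop (𝓝 ∞) := by
    refine ENNReal.tendsto_ofReal_atTop.comp (Tendsto.const_mul_atTop (by positivity) ?_)
    exact (tendsto_rpow_atTop (by linarith)).comp tendsto_natCast_atTop_atTop
  refine le_of_tendsto hlim ?_
  filter_upwards [eventually_gt_atTop 0,
    tendsto_natCast_atTop_atTop.eventually_ge_atTop (r / (16 * δ))] with m hm hmδ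
  have hm' : (0 : ℝ) < m := by exact_mod_cast hm
  obtain ⟨P, hP, hsum⟩ := exists_isBallPacking_of_ball_subset_closure hr hF hm (δ := δ) (by
    rw [div_le_iff₀ (by positivity)] at hmδ ⊢
    linarith) s
  rw [← hsum]
  exact le_iSup₂ (f := fun (P : Set (ℂ × ℝ)) (_ : IsBallPacking δ F P) =>
    ∑' b : P, ENNReal.ofReal (2 * b.1.2) ^ (s : ℝ)) P hP

/-- A set that is residual in some disc has packing dimension at least two. -/
theorem two_le_packingDim {E G U : Set ℂ} (hG : IsGδ G) (hGd : Dense G) (hU : IsOpen U)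
    (hUne : U.Nonempty) (hsub : G ∩ U ⊆ E) : 2 ≤ packingDim E := by
  refine le_of_forall_lt fun c hc => ?_
  obtain ⟨s, hs1, hs2⟩ := ENNReal.lt_iff_exists_nnreal_btwn.1 hc
  refine hs1.trans_le (le_iSup₂_of_le s ?_ le_rfl)
  refine iInf₂_eq_top.2 fun F hF => ?_
  -- The index `none` carries the complement of `U`, so that the closed sets cover all of `G`; the
  -- interior that Baire finds meeting `U` must then belong to some `closure (F i)`.
  let f : Option ℕ → Set ℂ := fun o => o.elim Uᶜ fun i => closure (F i)
  have hdense := hG.dense_iUnion_interior_of_closed hGd (f := f)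
    (by
      rintro (_ | i)
      exacts [hU.isClosed_compl, isClosed_closure])
    (by
      intro z hz
      by_cases hzU : z ∈ U
      · obtain ⟨i, hi⟩ := mem_iUnion.1 (hF (hsub ⟨hz, hzU⟩))
        exact mem_iUnion.2 ⟨some i, subset_closure hi⟩
      · exact mem_iUnion.2 ⟨none, hzU⟩)
  obtain ⟨z, hzU, hz⟩ := hdense.inter_open_nonempty U hU hUne
  obtain ⟨o, ho⟩ := mem_iUnion.1 hz
  rcases o with _ | i
  · exact absurd hzU (interior_subset ho)
  · obtain ⟨r, hr, hball⟩ := Metric.isOpen_iff.1 isOpen_interior z ho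
    have htop := packingPremeasure_eq_top_of_ball_subset_closure hr
      (hball.trans interior_subset) (s := s) (by exact_mod_cast hs2)
    exact ENNReal.tsum_eq_top_of_eq_top ⟨i, htop⟩

/-! ### Packing dimension of W(ψ) -/

theorem closedBall_subset_hurwitzDomain :
    closedBall (1 / 4 : ℂ) (1 / 8) ⊆ hurwitzDomain \ {0} := by
  intro z hz
  rw [mem_closedBall, dist_eq_norm] at hz
  have h1 := abs_le.1 ((Complex.abs_re_le_norm _).trans hz)
  have h2 := abs_le.1 ((Complex.abs_im_le_norm _).trans hz)
  norm_num at h1 h2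
  refine ⟨⟨⟨by linarith, by linarith⟩, by linarith, by linarith⟩, ?_⟩
  rintro rfl
  norm_num at h1

/-- The points within `ψ |q|` of a Gaussian rational with denominator `q`, `|q| ≥ n`. -/
def approximableAt (ψ : ℝ → ℝ) (n : ℕ) : Set ℂ :=
  ⋃ pq ∈ {pq : GaussianInt × GaussianInt | pq.2 ≠ 0 ∧ (n : ℝ) ≤ ‖(pq.2 : ℂ)‖},
    ball ((pq.1 : ℂ) / (pq.2 : ℂ)) (ψ ‖(pq.2 : ℂ)‖)

theorem isOpen_approximableAt (ψ : ℝ → ℝ) (n : ℕ) : IsOpen (approximableAt ψ n) :=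
  isOpen_biUnion fun _ _ => isOpen_ball

/-- The nearest Gaussian integer. -/
theorem exists_gaussianInt_norm_sub_le (z : ℂ) : ∃ p : GaussianInt, ‖z - p‖ ≤ 1 := by
  refine ⟨⟨round z.re, round z.im⟩, (Complex.norm_le_abs_re_add_abs_im _).trans ?_⟩
  have h1 := abs_sub_round z.re
  have h2 := abs_sub_round z.im
  simp only [Complex.sub_re, Complex.sub_im, GaussianInt.re_toComplex, GaussianInt.im_toComplex]
  linarith

/-- Natural denominators suffice: if p is a Gaussian integer near mz, then p/m is within 1/m of z.
-/
theorem dense_approximableAt {ψ : ℝ → ℝ} (hpos : ∀ x, 0 < x → 0 < ψ x) (n : ℕ) :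
    Dense (approximableAt ψ n) := by
  intro z
  refine Metric.mem_closure_iff.2 fun ε hε => ?_
  obtain ⟨m, hm⟩ := exists_nat_gt (max (n : ℝ) (1 / ε))
  have hmn : (n : ℝ) < m := (le_max_left _ _).trans_lt hm
  have hmε : 1 / ε < m := (le_max_right _ _).trans_lt hm
  have hm0 : (0 : ℝ) < m := (Nat.cast_nonneg n).trans_lt hmn
  obtain ⟨p, hp⟩ := exists_gaussianInt_norm_sub_le (z * m)
  have hq : (((m : GaussianInt)) : ℂ) = m := map_natCast _ _
  have hqn : ‖((m : GaussianInt) : ℂ)‖ = m := by rw [hq, Complex.norm_natCast]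
  refine ⟨(p : ℂ) / m, ?_, ?_⟩
  · refine mem_biUnion (x := (p, (m : GaussianInt))) ⟨?_, ?_⟩ ?_
    · intro h0
      simp only at h0
      rw [h0] at hqn
      simp only [GaussianInt.toComplex_zero, norm_zero] at hqn
      linarith
    · simpa only [hqn] using hmn.le
    · simp only [hqn]
      rw [hq]
      exact mem_ball_self (hpos _ hm0)
  · have hmc : (m : ℂ) ≠ 0 := by exact_mod_cast hm0.ne'
    have h1 : z - p / m = (z * m - p) / m := by field_simp
    rw [dist_eq_norm, h1, norm_div, Complex.norm_natCast, div_lt_iff₀ hm0]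
    rw [div_lt_iff₀ hε] at hmε
    linarith

theorem packingDim_approximableSet {ψ : ℝ → ℝ} (hpos : ∀ x, 0 < x → 0 < ψ x) :
    packingDim (approximableSet ψ) = 2 := by
  refine le_antisymm (packingDim_le_two_of_bounded (R := 1) fun z hz => ?_) ?_
  · simpa using norm_le_one_of_mem_hurwitzDomain hz.1.1
  · refine two_le_packingDim (G := ⋂ n, approximableAt ψ n) (U := ball (1 / 4 : ℂ) (1 / 8))
      (.iInter fun n => (isOpen_approximableAt ψ n).isGδ)
      (dense_iInter_of_isOpen (isOpen_approximableAt ψ) (dense_approximableAt hpos))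
      isOpen_ball ⟨_, mem_ball_self (by norm_num)⟩ ?_
    rintro z ⟨hzG, hzU⟩
    refine ⟨closedBall_subset_hurwitzDomain (ball_subset_closedBall hzU), fun hfin => ?_⟩
    obtain ⟨B, hB⟩ := (hfin.image fun pq => ‖(pq.2 : ℂ)‖).bddAbove
    obtain ⟨n, hn⟩ := exists_nat_gt B
    obtain ⟨pq, ⟨hq, hnq⟩, hz⟩ := mem_iUnion₂.1 (mem_iInter.1 hzG n)
    rw [mem_ball, dist_eq_norm] at hz
    have := hB ⟨pq, ⟨hq, hz.le⟩, rfl⟩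
    simp only at this
    linarith

/-! ### Dirichlet's theorem and the count of Gaussian rationals -/

theorem abs_sub_sub_floor_sub_le {n : ℕ} (hn : 0 < n) {x y : ℝ}
    (h : ⌊n * Int.fract x⌋ = ⌊n * Int.fract y⌋) : |x - y - ((⌊x⌋ - ⌊y⌋ : ℤ) : ℝ)| ≤ 1 / n := by
  have hn' : (0 : ℝ) < n := by exact_mod_cast hn
  have h1 := Int.abs_sub_lt_one_of_floor_eq_floor h
  rw [← mul_sub, abs_mul, abs_of_pos hn'] at h1
  have h2 : x - y - ((⌊x⌋ - ⌊y⌋ : ℤ) : ℝ) = Int.fract x - Int.fract y := by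
    simp only [Int.fract]; push_cast; ring
  rw [h2, le_div_iff₀ hn']
  linarith

/-- **Dirichlet's approximation theorem** for Gaussian integers. -/
theorem GaussianInt.exists_norm_mul_sub_le (z : ℂ) {n : ℕ} (hn : 0 < n) :
    ∃ p q : GaussianInt, q ≠ 0 ∧ ‖(q : ℂ)‖ ≤ 2 * n ∧ ‖(q : ℂ) * z - p‖ ≤ 2 / n := by
  let γ : Fin (n + 1) × Fin (n + 1) → GaussianInt := fun a => ⟨a.1, a.2⟩
  have hγ : Function.Injective γ := by
    rintro ⟨a, b⟩ ⟨a', b'⟩ hab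
    simp only [γ, Zsqrtd.mk.injEq, Nat.cast_inj, Fin.val_inj] at hab
    exact Prod.ext hab.1 hab.2
  have hfl (x : ℝ) : ⌊n * Int.fract x⌋ ∈ Finset.Ico (0 : ℤ) n := by
    have hn' : (0 : ℝ) < n := by exact_mod_cast hn
    rw [Finset.mem_Ico]
    refine ⟨Int.floor_nonneg.2 (mul_nonneg hn'.le (Int.fract_nonneg x)), Int.floor_lt.2 ?_⟩
    have := Int.fract_lt_one x
    push_cast
    nlinarith
  -- Pigeonhole: (n + 1)² multipliers, n² cells of the unit square modulo ℤ[i].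
  obtain ⟨a, -, b, -, hab, heq⟩ := Finset.exists_ne_map_eq_of_card_lt_of_maps_to
    (s := (Finset.univ : Finset (Fin (n + 1) × Fin (n + 1))))
    (t := Finset.Ico (0 : ℤ) n ×ˢ Finset.Ico (0 : ℤ) n)
    (f := fun a => (⌊n * Int.fract ((γ a : ℂ) * z).re⌋, ⌊n * Int.fract ((γ a : ℂ) * z).im⌋))
    (by
      simp only [Finset.card_product, Int.card_Ico, Finset.card_univ, Fintype.card_prod,
        Fintype.card_fin]
      simp only [sub_zero, Int.toNat_natCast]
      nlinarith)
    (fun a _ => Finset.mem_coe.2 (Finset.mem_product.2 ⟨hfl _, hfl _⟩))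
  simp only [Prod.mk.injEq] at heq
  have h1 := abs_sub_sub_floor_sub_le hn heq.1
  have h2 := abs_sub_sub_floor_sub_le hn heq.2
  refine ⟨⟨⌊((γ a : ℂ) * z).re⌋ - ⌊((γ b : ℂ) * z).re⌋,
    ⌊((γ a : ℂ) * z).im⌋ - ⌊((γ b : ℂ) * z).im⌋⟩, γ a - γ b, sub_ne_zero.2 (hγ.ne hab), ?_, ?_⟩
  · have key (i j : Fin (n + 1)) : |((i : ℕ) : ℝ) - ((j : ℕ) : ℝ)| ≤ n := by
      have h3 : ((i : ℕ) : ℝ) ≤ n := by exact_mod_cast Nat.lt_succ_iff.1 i.2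
      have h4 : ((j : ℕ) : ℝ) ≤ n := by exact_mod_cast Nat.lt_succ_iff.1 j.2
      have h5 : (0 : ℝ) ≤ (i : ℕ) := Nat.cast_nonneg _
      have h6 : (0 : ℝ) ≤ (j : ℕ) := Nat.cast_nonneg _
      exact abs_le.2 ⟨by linarith, by linarith⟩
    refine (Complex.norm_le_abs_re_add_abs_im _).trans ?_
    simp only [γ, GaussianInt.toComplex_sub, Complex.sub_re, Complex.sub_im,
      GaussianInt.re_toComplex, GaussianInt.im_toComplex, Int.cast_natCast]
    linarith [key a.1 b.1, key a.2 b.2]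
  · refine (Complex.norm_le_abs_re_add_abs_im _).trans ?_
    rw [GaussianInt.toComplex_sub, sub_mul]
    simp only [Complex.sub_re, Complex.sub_im, GaussianInt.re_toComplex,
      GaussianInt.im_toComplex]
    calc _ ≤ 1 / (n : ℝ) + 1 / n := add_le_add h1 h2
      _ = 2 / n := by ring

/-- Dirichlet with n = ⌊Q/2⌋; the hypothesis 4 ≤ Q ensures Q ≤ 4n, hence 2/n ≤ 8/Q. -/
theorem exists_gaussianRat_near (z : ℂ) {Q : ℝ} (hQ : 4 ≤ Q) :
    ∃ p q : GaussianInt, q ≠ 0 ∧ ‖(q : ℂ)‖ ≤ Q ∧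
      dist z ((p : ℂ) / q) ≤ 8 / (‖(q : ℂ)‖ * Q) := by
  have hn : 0 < ⌊Q / 2⌋₊ := Nat.floor_pos.2 (by linarith)
  have h1 := Nat.floor_le (show 0 ≤ Q / 2 by linarith)
  have h2 := Nat.lt_floor_add_one (Q / 2)
  obtain ⟨p, q, hq, hqQ, hpq⟩ := GaussianInt.exists_norm_mul_sub_le z hn
  refine ⟨p, q, hq, by linarith, ?_⟩
  have hqc : (q : ℂ) ≠ 0 := by simpa using hq
  have hq0 : 0 < ‖(q : ℂ)‖ := norm_pos_iff.2 hqc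
  have h3 : z - (p : ℂ) / q = (q * z - p) / q := by field_simp
  have hn' : (0 : ℝ) < (⌊Q / 2⌋₊ : ℝ) := by exact_mod_cast hn
  rw [dist_eq_norm, h3, norm_div, div_le_div_iff₀ hq0 (by positivity)]
  rw [le_div_iff₀ hn'] at hpq
  have h4 : ‖(q : ℂ) * z - p‖ * Q ≤ 8 := by
    have h5 : Q ≤ 4 * (⌊Q / 2⌋₊ : ℝ) := by linarith
    nlinarith [norm_nonneg ((q : ℂ) * z - p)]
  nlinarith

theorem sq_le_sum_sq_of_ball_subset {ι : Type*} (F : Finset ι) {c : ι → ℂ} {ρ : ι → ℝ} {x : ℂ}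
    {R : ℝ} (hR : 0 ≤ R) (hρ : ∀ i ∈ F, 0 ≤ ρ i)
    (hsub : ball x R ⊆ ⋃ i ∈ F, closedBall (c i) (ρ i)) : R ^ 2 ≤ ∑ i ∈ F, ρ i ^ 2 := by
  have h := (measure_mono (μ := volume) hsub).trans (measure_biUnion_finset_le F _)
  simp only [Complex.volume_ball, Complex.volume_closedBall, ← Finset.sum_mul] at h
  have hpi : (NNReal.pi : ℝ≥0∞) ≠ 0 := by
    simpa using NNReal.pi_ne_zero
  rw [ENNReal.mul_le_mul_iff_left hpi ENNReal.coe_ne_top, ← ENNReal.ofReal_pow hR] at h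
  have h2 : ∑ i ∈ F, ENNReal.ofReal (ρ i) ^ 2 = ENNReal.ofReal (∑ i ∈ F, ρ i ^ 2) := by
    rw [ENNReal.ofReal_sum_of_nonneg fun i _ => sq_nonneg _]
    exact Finset.sum_congr rfl fun i hi => (ENNReal.ofReal_pow (hρ i hi) 2).symm
  rw [h2] at h
  exact (ENNReal.ofReal_le_ofReal_iff (Finset.sum_nonneg fun i _ => sq_nonneg _)).1 h

theorem GaussianInt.one_le_dist_toComplex {p q : GaussianInt} (h : p ≠ q) :
    1 ≤ dist (p : ℂ) (q : ℂ) := by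
  rw [dist_eq_norm, ← GaussianInt.toComplex_sub]
  exact GaussianInt.one_le_norm_toComplex (sub_ne_zero.2 h)

theorem GaussianInt.card_le_of_dist_le (F : Finset GaussianInt) {x : ℂ} {R : ℝ} (hR : 0 ≤ R)
    (h : ∀ p ∈ F, dist (p : ℂ) x ≤ R) : (F.card : ℝ) ≤ (2 * R + 1) ^ 2 := by
  simpa using card_mul_sq_le_of_separated F one_pos hR
    (fun p _ q _ hpq => GaussianInt.one_le_dist_toComplex hpq) h

/-- The number of numerators `p` with `p / q` in a disc of radius `r`, relative to `|q|²`. -/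
theorem card_numerators_div_sq_le {q : GaussianInt} (hq : q ≠ 0) (A : Finset GaussianInt) {x : ℂ}
    {r : ℝ} (hr : 0 < r) (hA : ∀ p ∈ A, dist ((p : ℂ) / q) x ≤ r) :
    (A.card : ℝ) / ‖(q : ℂ)‖ ^ 2 ≤ 9 * r ^ 2 + if ‖(q : ℂ)‖ ≤ 1 / r then 9 else 0 := by
  have hq1 := GaussianInt.one_le_norm_toComplex hq
  have hqc : (q : ℂ) ≠ 0 := by simpa using hq
  have hcard : (A.card : ℝ) ≤ (2 * (r * ‖(q : ℂ)‖) + 1) ^ 2 := by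
    refine GaussianInt.card_le_of_dist_le A (x := x * q) (by positivity) fun p hp => ?_
    have h1 : (p : ℂ) - x * q = (p / q - x) * q := by field_simp
    have h2 := hA p hp
    rw [dist_eq_norm] at h2 ⊢
    rw [h1, norm_mul]
    gcongr
  rw [div_le_iff₀ (by positivity)]
  refine hcard.trans ?_
  -- If r|q| ≤ 1 the count is at most 9 ≤ 9|q|²; otherwise 2r|q| + 1 ≤ 3r|q|.
  split_ifs with h
  · rw [le_div_iff₀ hr] at h
    nlinarith [mul_pos hr (zero_lt_one.trans_le hq1), sq_nonneg (r * ‖(q : ℂ)‖)]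
  · rw [not_le, div_lt_iff₀ hr] at h
    nlinarith

/-- The Gaussian rationals of denominator at most `Q` are as dense as a square lattice of mesh
`Q⁻²`, at all scales `r` with `r² Q` large. -/
theorem exists_finset_gaussianRat {r Q : ℝ} (hr : 0 < r) (hr1 : r ≤ 1) (hQ : 300 ≤ r ^ 2 * Q)
    (x : ℂ) : ∃ T : Finset ℂ, (∀ t ∈ T, dist t x ≤ r ∧
      ∃ p q : GaussianInt, q ≠ 0 ∧ ‖(q : ℂ)‖ ≤ Q ∧ t = (p : ℂ) / q) ∧
      r ^ 2 * Q ^ 4 ≤ 10 ^ 8 * T.card := by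
  classical
  have hr2 : r ^ 2 ≤ r := by nlinarith
  have hQ0 : 0 < Q := by
    by_contra! h
    nlinarith [sq_nonneg r]
  have hrQ : 300 ≤ r * Q := by nlinarith
  have hQ300 : 300 ≤ Q := by nlinarith
  have hfinp (q : GaussianInt) (hq : q ≠ 0) :
      {p : GaussianInt | dist ((p : ℂ) / q) x ≤ r}.Finite := by
    refine (finite_setOf_norm_toComplex_le ((‖x‖ + r) * ‖(q : ℂ)‖)).subset fun p hp => ?_
    refine norm_le_of_norm_sub_div_le (by simpa using hq) ?_
    rw [← dist_eq_norm, dist_comm]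
    exact hp
  have hfin : {pq : GaussianInt × GaussianInt | pq.2 ≠ 0 ∧ ‖(pq.2 : ℂ)‖ ≤ Q ∧
      dist ((pq.1 : ℂ) / pq.2) x ≤ r}.Finite := by
    refine ((finite_setOf_norm_toComplex_le ((‖x‖ + r) * Q)).prod
      (finite_setOf_norm_toComplex_le Q)).subset ?_
    rintro ⟨p, q⟩ ⟨hq, hqQ, hpq⟩
    refine ⟨?_, hqQ⟩
    rw [dist_comm, dist_eq_norm] at hpq
    refine (norm_le_of_norm_sub_div_le (by simpa using hq) hpq).trans ?_
    gcongr
  obtain ⟨T, hT⟩ : ∃ T : Finset ℂ, ∀ t, t ∈ T ↔ ∃ p q : GaussianInt, (q ≠ 0 ∧ ‖(q : ℂ)‖ ≤ Q ∧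
      dist ((p : ℂ) / q) x ≤ r) ∧ (p : ℂ) / q = t :=
    ⟨(hfin.image fun pq => (pq.1 : ℂ) / pq.2).toFinset, fun t => by simp⟩
  obtain ⟨S, hS⟩ : ∃ S : Finset GaussianInt, ∀ q, q ∈ S ↔ q ≠ 0 ∧ ‖(q : ℂ)‖ ≤ Q / 300 :=
    ⟨(finite_setOf_norm_toComplex_le (Q / 300)).toFinset.erase 0, fun q => by simp⟩
  obtain ⟨A, hA⟩ : ∃ A : GaussianInt → Finset GaussianInt, ∀ q, q ≠ 0 → ∀ p, p ∈ A q ↔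
      dist ((p : ℂ) / q) x ≤ r :=
    ⟨fun q => if hq : q ≠ 0 then (hfinp q hq).toFinset else ∅, fun q hq p => by simp [hq]⟩
  clear hfinp hfin
  refine ⟨T, ?_, ?_⟩
  · intro t ht
    obtain ⟨p, q, ⟨hq, hqQ, hd⟩, rfl⟩ := (hT t).1 ht
    exact ⟨hd, p, q, hq, hqQ, rfl⟩
  -- Dirichlet discs cover the half-size disc. Fractions with |q| > Q/300 get the common radius 8 ·
  -- 300/Q² and are indexed as points of `T`, so a fraction with several representations counts
  -- once; smaller denominators are indexed as pairs.
  have hcover : ball x (r / 2) ⊆ ⋃ i ∈ T.disjSum (S.sigma A),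
      closedBall (Sum.elim id (fun a : Σ _ : GaussianInt, GaussianInt => (a.2 : ℂ) / a.1) i)
        (Sum.elim (fun _ => 2400 / Q ^ 2)
          (fun a : Σ _ : GaussianInt, GaussianInt => 8 / (‖(a.1 : ℂ)‖ * Q)) i) := by
    intro z hz
    obtain ⟨p, q, hq, hqQ, hpq⟩ := exists_gaussianRat_near z (Q := Q) (by linarith)
    have hq1 := GaussianInt.one_le_norm_toComplex hq
    have hd : dist ((p : ℂ) / q) x ≤ r := by
      have h1 : 8 / (‖(q : ℂ)‖ * Q) ≤ r / 2 := by
        rw [div_le_iff₀ (by positivity)]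
        nlinarith [mul_pos hr hQ0]
      have h2 := dist_triangle_left ((p : ℂ) / q) x z
      have h3 := mem_ball.1 hz
      linarith
    by_cases hsmall : ‖(q : ℂ)‖ ≤ Q / 300
    · refine mem_iUnion₂.2 ⟨Sum.inr ⟨q, p⟩, ?_, ?_⟩
      · exact Finset.inr_mem_disjSum.2
          (Finset.mem_sigma.2 ⟨(hS q).2 ⟨hq, hsmall⟩, (hA q hq p).2 hd⟩)
      · simpa only [Sum.elim_inr, mem_closedBall] using hpq
    · refine mem_iUnion₂.2 ⟨Sum.inl ((p : ℂ) / q), ?_, ?_⟩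
      · exact Finset.inl_mem_disjSum.2 ((hT _).2 ⟨p, q, ⟨hq, hqQ, hd⟩, rfl⟩)
      · simp only [Sum.elim_inl, mem_closedBall, id]
        refine hpq.trans ?_
        rw [div_le_div_iff₀ (by positivity) (by positivity)]
        push Not at hsmall
        nlinarith
  have harea := sq_le_sum_sq_of_ball_subset _ (by positivity) (by
    rintro (t | a) - <;> simp only [Sum.elim_inl, Sum.elim_inr] <;> positivity) hcover
  rw [Finset.sum_disjSum, Finset.sum_sigma] at harea
  simp only [Sum.elim_inl, Sum.elim_inr, Finset.sum_const, nsmul_eq_mul] at harea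
  have hterm (q : GaussianInt) (hq : q ∈ S) : ((A q).card : ℝ) * (8 / (‖(q : ℂ)‖ * Q)) ^ 2 ≤
      64 / Q ^ 2 * (9 * r ^ 2 + if ‖(q : ℂ)‖ ≤ 1 / r then 9 else 0) := by
    have hq0 := ((hS q).1 hq).1
    have hq1 := GaussianInt.one_le_norm_toComplex hq0
    have h1 := card_numerators_div_sq_le hq0 (A q) hr fun p hp => (hA q hq0 p).1 hp
    calc ((A q).card : ℝ) * (8 / (‖(q : ℂ)‖ * Q)) ^ 2
        = 64 / Q ^ 2 * ((A q).card / ‖(q : ℂ)‖ ^ 2) := by field_simp; norm_num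
      _ ≤ _ := by gcongr
  have hsum := Finset.sum_le_sum hterm
  rw [← Finset.mul_sum, Finset.sum_add_distrib, Finset.sum_const, nsmul_eq_mul,
    ← Finset.sum_filter, Finset.sum_const, nsmul_eq_mul] at hsum
  have hScard : (S.card : ℝ) ≤ 9 * (Q / 300) ^ 2 := by
    refine (GaussianInt.card_le_of_dist_le S (x := 0) (R := Q / 300) (by positivity) fun q hq => by
      simpa using ((hS q).1 hq).2).trans ?_
    nlinarith
  have hS'card : ((S.filter fun q : GaussianInt => ‖(q : ℂ)‖ ≤ 1 / r).card : ℝ) ≤ 9 / r ^ 2 := by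
    refine (GaussianInt.card_le_of_dist_le _ (x := 0) (R := 1 / r) (by positivity) fun q hq => by
      simpa using (Finset.mem_filter.1 hq).2).trans ?_
    have h1 : 1 ≤ 1 / r := by rw [le_div_iff₀ hr]; linarith
    calc (2 * (1 / r) + 1) ^ 2 ≤ (2 * (1 / r) + 1 / r) ^ 2 := by gcongr
      _ = 9 / r ^ 2 := by field_simp; norm_num
  -- Small denominators account for at most half of (r/2)², so the discs about `T` must supply the
  -- other r²/8.
  have hsmall : 64 / Q ^ 2 * (9 * (Q / 300) ^ 2 * (9 * r ^ 2) + 9 / r ^ 2 * 9) ≤ r ^ 2 / 8 := by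
    have h1 : 64 / Q ^ 2 * (9 * (Q / 300) ^ 2 * (9 * r ^ 2) + 9 / r ^ 2 * 9) =
        5184 / 90000 * r ^ 2 + 5184 / (r ^ 2 * Q) ^ 2 * r ^ 2 := by
      field_simp
      ring
    have h2 : 5184 / (r ^ 2 * Q) ^ 2 ≤ 5184 / 90000 := by
      gcongr
      nlinarith
    nlinarith [sq_nonneg r]
  have hsum2 : 64 / Q ^ 2 * ((S.card : ℝ) * (9 * r ^ 2) +
      ((S.filter fun q : GaussianInt => ‖(q : ℂ)‖ ≤ 1 / r).card : ℝ) * 9) ≤ r ^ 2 / 8 :=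
    le_trans (by gcongr) hsmall
  have hmain : r ^ 2 / 8 ≤ T.card * (2400 / Q ^ 2) ^ 2 := by linarith
  rw [div_pow, mul_div_assoc', le_div_iff₀ (by positivity)] at hmain
  have hT0 : (0 : ℝ) ≤ T.card := Nat.cast_nonneg _
  nlinarith

/-! ### Trees of discs and the mass distribution principle -/

/-- The centre of the disc of generation `n` with code `ω`, in the tree of discs with root `x₀` in
which `child n x j` is the centre of the `j`-th child of a disc of generation `n` centred at `x`. -/
def treeCenter {M : ℕ → ℕ} (child : ∀ n, ℂ → Fin (M n) → ℂ) (x₀ : ℂ) (ω : ∀ n, Fin (M n)) : ℕ → ℂ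
  | 0 => x₀
  | n + 1 => child n (treeCenter child x₀ ω n) (ω n)

section Tree

variable {M : ℕ → ℕ} {child : ∀ n, ℂ → Fin (M n) → ℂ} {x₀ : ℂ}

theorem treeCenter_congr {ω ω' : ∀ n, Fin (M n)} {n : ℕ} (h : ∀ i < n, ω i = ω' i) :
    treeCenter child x₀ ω n = treeCenter child x₀ ω' n := by
  induction n with
  | zero => rfl
  | succ n ih =>
    simp only [treeCenter]
    rw [ih fun i hi => h i (hi.trans n.lt_succ_self), h n n.lt_succ_self]

theorem isLocallyConstant_treeCenter (n : ℕ) :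
    IsLocallyConstant fun ω : ∀ n, Fin (M n) => treeCenter child x₀ ω n := by
  induction n with
  | zero => exact IsLocallyConstant.const x₀
  | succ n ih =>
    have h : IsLocallyConstant fun ω : ∀ n, Fin (M n) => ω n :=
      (IsLocallyConstant.iff_continuous _).2 (continuous_apply n)
    exact ih.comp₂ h (child n)

/-- Radii at least halve, so a step of length ρₘ/2 is at most ρₘ - ρₘ₊₁ and the distances telescope.
-/
theorem dist_treeCenter_le {ρ : ℕ → ℝ} (hρ2 : ∀ n, ρ (n + 1) ≤ ρ n / 2)
    (hchild : ∀ n x j, dist (child n x j) x ≤ ρ n / 2) (ω : ∀ n, Fin (M n)) {n m : ℕ}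
    (hnm : n ≤ m) : dist (treeCenter child x₀ ω m) (treeCenter child x₀ ω n) ≤ ρ n - ρ m := by
  induction m, hnm using Nat.le_induction with
  | base => simp
  | succ m _ ih =>
    have h1 := hchild m (treeCenter child x₀ ω m) (ω m)
    have h2 := hρ2 m
    have h3 := dist_triangle (treeCenter child x₀ ω (m + 1)) (treeCenter child x₀ ω m)
      (treeCenter child x₀ ω n)
    simp only [treeCenter] at h3 ⊢
    linarith

theorem le_div_two_pow_of_halving {ρ : ℕ → ℝ} (hρ2 : ∀ n, ρ (n + 1) ≤ ρ n / 2) (n : ℕ) :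
    ρ n ≤ ρ 0 / 2 ^ n := by
  induction n with
  | zero => simp
  | succ n ih =>
    calc ρ (n + 1) ≤ ρ n / 2 := hρ2 n
      _ ≤ ρ 0 / 2 ^ n / 2 := by gcongr
      _ = ρ 0 / 2 ^ (n + 1) := by rw [pow_succ]; field_simp

theorem exists_tendsto_treeCenter {ρ : ℕ → ℝ} (hρ : ∀ n, 0 < ρ n)
    (hρ2 : ∀ n, ρ (n + 1) ≤ ρ n / 2) (hchild : ∀ n x j, dist (child n x j) x ≤ ρ n / 2)
    (ω : ∀ n, Fin (M n)) : ∃ z, Tendsto (treeCenter child x₀ ω) atTop (𝓝 z) ∧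
      ∀ n, dist z (treeCenter child x₀ ω n) ≤ ρ n := by
  have hcauchy : CauchySeq (treeCenter child x₀ ω) := by
    refine cauchySeq_of_le_geometric_two (C := ρ 0) fun n => ?_
    rw [dist_comm]
    calc _ ≤ ρ n / 2 := hchild n _ _
      _ ≤ ρ 0 / 2 ^ n / 2 := by gcongr; exact le_div_two_pow_of_halving hρ2 n
      _ = ρ 0 / 2 / 2 ^ n := by ring
  obtain ⟨z, hz⟩ := cauchySeq_tendsto_of_complete hcauchy
  refine ⟨z, hz, fun n => ?_⟩
  refine le_of_tendsto (hz.dist tendsto_const_nhds) ?_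
  filter_upwards [eventually_ge_atTop n] with m hm
  have := dist_treeCenter_le (x₀ := x₀) hρ2 hchild ω hm
  linarith [hρ m]

/-- The uniform measure on the space of codes. -/
noncomputable def codeMeasure (M : ℕ → ℕ) [∀ n, NeZero (M n)] : Measure (∀ n, Fin (M n)) :=
  Measure.infinitePi fun n => (PMF.uniformOfFintype (Fin (M n))).toMeasure

instance (M : ℕ → ℕ) [∀ n, NeZero (M n)] : IsProbabilityMeasure (codeMeasure M) := by
  unfold codeMeasure; infer_instance

theorem codeMeasure_cylinder [∀ n, NeZero (M n)] (ω : ∀ n, Fin (M n)) (n : ℕ) :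
    codeMeasure M {ω' | ∀ i < n, ω' i = ω i} =
      ENNReal.ofReal (∏ i ∈ Finset.range n, (M i : ℝ))⁻¹ := by
  have h1 : {ω' : ∀ n, Fin (M n) | ∀ i < n, ω' i = ω i} =
      Set.pi (Finset.range n) fun i => {ω i} := by
    ext ω'; simp [Set.mem_pi]
  have hpos (i : ℕ) : (0 : ℝ) < M i := by exact_mod_cast NeZero.pos (M i)
  rw [h1, codeMeasure, Measure.infinitePi_pi _ fun i _ => measurableSet_singleton _,
    ← Finset.prod_inv_distrib, ENNReal.ofReal_prod_of_nonneg fun i _ => (inv_pos.2 (hpos i)).le]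
  refine Finset.prod_congr rfl fun i _ => ?_
  rw [PMF.toMeasure_apply_singleton _ _ (measurableSet_singleton _), PMF.uniformOfFintype_apply,
    Fintype.card_fin, ENNReal.ofReal_inv_of_pos (hpos i), ENNReal.ofReal_natCast]

/-- A set of codes whose points lie close together has small mass. -/
theorem codeMeasure_le_of_dist_le [∀ n, NeZero (M n)] {ρ δ : ℕ → ℝ} {s : ℝ≥0} {K κ d : ℝ}
    {π : (∀ n, Fin (M n)) → ℂ} (hM : ∀ n, 2 ≤ M n) (hρ : ∀ n, 0 < ρ n)
    (hδ : ∀ n, 0 < δ n) (hδρ : ∀ n, 4 * ρ (n + 1) ≤ δ n)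
    (hsep : ∀ n x i j, i ≠ j → δ n ≤ dist (child n x i) (child n x j))
    (hπ : ∀ ω n, dist (π ω) (treeCenter child x₀ ω n) ≤ ρ n)
    (hs : s ≤ 2) (hK : 1 ≤ K) (hcount : ∀ n, ρ n ^ 2 ≤ K * M n * δ n ^ 2) (hκ : 0 < κ)
    (hmass : ∀ n, κ ≤ (∏ i ∈ Finset.range n, (M i : ℝ)) * ρ n ^ (s : ℝ))
    {A : Set (∀ n, Fin (M n))} (hA : ∀ ω ∈ A, ∀ ω' ∈ A, dist (π ω) (π ω') ≤ d) (hd : 0 ≤ d) :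
    codeMeasure M A ≤ ENNReal.ofReal (36 * K / κ * d ^ (s : ℝ)) := by
  classical
  rcases A.eq_empty_or_nonempty with rfl | ⟨ω, hω⟩
  · simp
  have hMpos (i : ℕ) : (0 : ℝ) < M i := by exact_mod_cast NeZero.pos (M i)
  have hN (n : ℕ) : 0 < ∏ i ∈ Finset.range n, (M i : ℝ) := Finset.prod_pos fun i _ => hMpos i
  -- If the codes in `A` never branch, `A` lies in cylinders of mass at most 2⁻ⁿ for all n.
  by_cases hall : ∀ n, ∀ ω' ∈ A, ω' n = ω n
  · have hzero : codeMeasure M A ≤ 0 := by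
      have hlim : Tendsto (fun n : ℕ => ENNReal.ofReal ((2 : ℝ) ^ n)⁻¹) atTop (𝓝 0) := by
        rw [← ENNReal.ofReal_zero]
        exact ENNReal.tendsto_ofReal
          (tendsto_inv_atTop_zero.comp (tendsto_pow_atTop_atTop_of_one_lt (by norm_num)))
      refine ge_of_tendsto' hlim fun n => ?_
      refine (measure_mono (t := {ω' | ∀ i < n, ω' i = ω i}) fun ω' hω' i _ => hall i ω' hω').trans
        ((codeMeasure_cylinder ω n).le.trans (ENNReal.ofReal_le_ofReal ?_))
      gcongr
      calc (2 : ℝ) ^ n = ∏ i ∈ Finset.range n, (2 : ℝ) := by simp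
        _ ≤ _ := Finset.prod_le_prod (fun _ _ => by norm_num) fun i _ => by exact_mod_cast hM i
    exact hzero.trans bot_le
  push Not at hall
  obtain ⟨ω₁, hω₁, hne⟩ := Nat.find_spec hall
  -- The first generation at which codes in `A` differ: all of `A` descends from one disc of radius
  -- ρₙ, through at least two of its children.
  set n := Nat.find hall
  have hagree (ω' : ∀ n, Fin (M n)) (hω' : ω' ∈ A) (i : ℕ) (hi : i < n) : ω' i = ω i := by
    by_contra h
    exact Nat.find_min hall hi ⟨ω', hω', h⟩
  have hcenter (ω' : ∀ n, Fin (M n)) (hω' : ω' ∈ A) :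
      dist (π ω') (child n (treeCenter child x₀ ω n) (ω' n)) ≤ ρ (n + 1) := by
    have := hπ ω' (n + 1)
    rwa [treeCenter, treeCenter_congr (hagree ω' hω')] at this
  -- Two children are δₙ apart and each limit point is within ρₙ₊₁ ≤ δₙ/4 of its own child.
  have hdδ : δ n ≤ 2 * d := by
    have h1 := hsep n (treeCenter child x₀ ω n) _ _ hne
    have h2 := dist_triangle4 (child n (treeCenter child x₀ ω n) (ω₁ n)) (π ω₁) (π ω)
      (child n (treeCenter child x₀ ω n) (ω n))
    rw [dist_comm _ (π ω₁)] at h2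
    linarith [hcenter ω₁ hω₁, hcenter ω hω, hA ω₁ hω₁ ω hω, hδρ n]
  have hdpos : 0 < d := by linarith [hδ n]
  let J : Finset (Fin (M n)) := Finset.univ.filter fun j => ∃ ω' ∈ A, ω' n = j
  have hJcard : (J.card : ℝ) * δ n ^ 2 ≤ 36 * d ^ 2 := by
    have h1 := card_mul_sq_le_of_separated J (c := child n (treeCenter child x₀ ω n)) (δ := δ n)
      (R := d + δ n / 4) (x := π ω) (hδ n) (by linarith [hδ n])
      (fun i _ j _ hij => hsep n _ i j hij)
      (fun j hj => by
        obtain ⟨ω', hω', rfl⟩ := (Finset.mem_filter.1 hj).2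
        have h2 := dist_triangle_left (child n (treeCenter child x₀ ω n) (ω' n)) (π ω) (π ω')
        linarith [hcenter ω' hω', hA ω' hω' ω hω, hδρ n])
    refine h1.trans ?_
    have h3 : 2 * (d + δ n / 4) + δ n ≤ 6 * d := by linarith
    calc (2 * (d + δ n / 4) + δ n) ^ 2 ≤ (6 * d) ^ 2 := by
          gcongr
          linarith [hδ n]
      _ = 36 * d ^ 2 := by ring
  set N := ∏ i ∈ Finset.range n, (M i : ℝ) with hNdef
  have hbound1 : codeMeasure M A ≤ ENNReal.ofReal N⁻¹ :=
    (measure_mono fun ω' hω' => hagree ω' hω').trans (codeMeasure_cylinder ω n).le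
  have hbound2 : codeMeasure M A ≤ ENNReal.ofReal (J.card * (N * M n)⁻¹) := by
    have hsub : A ⊆ ⋃ j ∈ J, {ω' | ∀ i < n + 1, ω' i = Function.update ω n j i} := by
      intro ω' hω'
      refine mem_iUnion₂.2 ⟨ω' n, Finset.mem_filter.2 ⟨Finset.mem_univ _, ω', hω', rfl⟩, ?_⟩
      intro i hi
      rcases Nat.lt_succ_iff_lt_or_eq.1 hi with hi | rfl
      · rw [Function.update_of_ne hi.ne, hagree ω' hω' i hi]
      · rw [Function.update_self]
    refine (measure_mono hsub).trans ((measure_biUnion_finset_le J _).trans ?_)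
    simp only [codeMeasure_cylinder, Finset.prod_range_succ, Finset.sum_const, nsmul_eq_mul]
    rw [ENNReal.ofReal_mul (Nat.cast_nonneg _), ENNReal.ofReal_natCast]
  have hscale : N⁻¹ * (d / ρ n) ^ (s : ℝ) ≤ d ^ (s : ℝ) / κ := by
    have hρs : 0 < ρ n ^ (s : ℝ) := Real.rpow_pos_of_pos (hρ n) _
    rw [Real.div_rpow hd (hρ n).le]
    calc N⁻¹ * (d ^ (s : ℝ) / ρ n ^ (s : ℝ)) = d ^ (s : ℝ) / (N * ρ n ^ (s : ℝ)) := by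
          field_simp
      _ ≤ d ^ (s : ℝ) / κ := by
          gcongr
          exact hmass n
  have hfinal : ∀ a : ℝ, a ≤ 36 * K * (N⁻¹ * (d / ρ n) ^ (s : ℝ)) →
      ENNReal.ofReal a ≤ ENNReal.ofReal (36 * K / κ * d ^ (s : ℝ)) := by
    intro a ha
    apply ENNReal.ofReal_le_ofReal
    calc a ≤ 36 * K * (N⁻¹ * (d / ρ n) ^ (s : ℝ)) := ha
      _ ≤ 36 * K * (d ^ (s : ℝ) / κ) := by gcongr
      _ = _ := by ring
  have hNinv : 0 < N⁻¹ := inv_pos.2 (hN n)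
  -- For d ≥ ρₙ the mass of the whole parent is already small enough. For d ≤ ρₙ, only a proportion
  -- of order (d/ρₙ)² of its children is met, and s ≤ 2 makes this at most (d/ρₙ)ˢ.
  rcases le_total (ρ n) d with hρd | hdρ
  · refine hbound1.trans (hfinal _ ?_)
    have h1 : 1 ≤ (d / ρ n) ^ (s : ℝ) :=
      Real.one_le_rpow ((one_le_div (hρ n)).2 hρd) s.coe_nonneg
    have h2 : N⁻¹ ≤ N⁻¹ * (d / ρ n) ^ (s : ℝ) := le_mul_of_one_le_right hNinv.le h1
    nlinarith
  · refine hbound2.trans (hfinal _ ?_)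
    have h1 : (d / ρ n) ^ (2 : ℝ) ≤ (d / ρ n) ^ (s : ℝ) :=
      Real.rpow_le_rpow_of_exponent_ge (div_pos hdpos (hρ n)) ((div_le_one (hρ n)).2 hdρ)
        (by exact_mod_cast hs)
    rw [Real.rpow_two] at h1
    calc (J.card : ℝ) * (N * M n)⁻¹ ≤ 36 * K * (N⁻¹ * (d / ρ n) ^ 2) := by
          have hρn := hρ n
          have hMn := hMpos n
          have hδn := hδ n
          have hJ : (J.card : ℝ) * ρ n ^ 2 ≤ 36 * K * M n * d ^ 2 := by
            calc (J.card : ℝ) * ρ n ^ 2 ≤ J.card * (K * M n * δ n ^ 2) := by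
                  gcongr
                  exact hcount n
              _ = K * M n * (J.card * δ n ^ 2) := by ring
              _ ≤ K * M n * (36 * d ^ 2) := by gcongr
              _ = _ := by ring
          have h2 : (J.card : ℝ) / M n ≤ 36 * K * (d / ρ n) ^ 2 := by
            rw [div_pow, mul_div_assoc', div_le_div_iff₀ hMn (by positivity)]
            linarith
          calc (J.card : ℝ) * (N * M n)⁻¹ = N⁻¹ * (J.card / M n) := by
                rw [mul_inv]; ring
            _ ≤ N⁻¹ * (36 * K * (d / ρ n) ^ 2) := by gcongr
            _ = _ := by ring
      _ ≤ _ := by gcongr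

/-- A lower bound for the Hausdorff dimension of the limit set of a homogeneous tree of discs. -/
theorem le_dimH_of_tree {ρ δ : ℕ → ℝ} {s : ℝ≥0} {K κ : ℝ} {E : Set ℂ} (hM : ∀ n, 2 ≤ M n)
    (hρ : ∀ n, 0 < ρ n) (hρ2 : ∀ n, ρ (n + 1) ≤ ρ n / 2)
    (hchild : ∀ n x j, dist (child n x j) x ≤ ρ n / 2)
    (hδ : ∀ n, 0 < δ n) (hδρ : ∀ n, 4 * ρ (n + 1) ≤ δ n)
    (hsep : ∀ n x i j, i ≠ j → δ n ≤ dist (child n x i) (child n x j))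
    (hs : s ≤ 2) (hK : 1 ≤ K) (hcount : ∀ n, ρ n ^ 2 ≤ K * M n * δ n ^ 2) (hκ : 0 < κ)
    (hmass : ∀ n, κ ≤ (∏ i ∈ Finset.range n, (M i : ℝ)) * ρ n ^ (s : ℝ))
    (hE : ∀ (z : ℂ) (w : ℕ → ℂ), w 0 = x₀ → (∀ n, ∃ j, w (n + 1) = child n (w n) j) →
      (∀ n, dist z (w n) ≤ ρ n) → z ∈ E) : (s : ℝ≥0∞) ≤ dimH E := by
  have : ∀ n, NeZero (M n) := fun n => ⟨by have := hM n; omega⟩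
  choose π hπ hπρ using fun ω : ∀ n, Fin (M n) =>
    exists_tendsto_treeCenter (x₀ := x₀) hρ hρ2 hchild ω
  have hmeas : Measurable π :=
    measurable_of_tendsto_metrizable
      (fun n => (isLocallyConstant_treeCenter (child := child) (x₀ := x₀) n).continuous.measurable)
      (tendsto_pi_nhds.2 hπ)
  set C : ℝ≥0∞ := ENNReal.ofReal (36 * K / κ) with hC
  have hCpos : 0 < 36 * K / κ := by positivity
  have hC0 : C ≠ 0 := by simpa [hC] using hCpos
  have hCt : C ≠ ∞ := ENNReal.ofReal_ne_top
  have hle : C⁻¹ • (codeMeasure M).map π ≤ μH[(s : ℝ)] := by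
    refine Measure.le_hausdorffMeasure _ _ 1 one_pos fun U hU => ?_
    have hUt : ediam U ≠ ∞ := (hU.trans_lt ENNReal.one_lt_top).ne
    have hUc : ediam (closure U) ≠ ∞ := by rwa [ediam_closure]
    have hmap : (codeMeasure M).map π U ≤ C * ediam U ^ (s : ℝ) := by
      -- The closure is measurable and has the same diameter.
      calc (codeMeasure M).map π U ≤ (codeMeasure M).map π (closure U) :=
            measure_mono subset_closure
        _ = codeMeasure M (π ⁻¹' closure U) :=
            Measure.map_apply hmeas isClosed_closure.measurableSet
        _ ≤ ENNReal.ofReal (36 * K / κ * diam U ^ (s : ℝ)) := by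
            refine codeMeasure_le_of_dist_le hM hρ hδ hδρ hsep hπρ hs hK hcount hκ hmass ?_
              diam_nonneg
            intro ω hω ω' hω'
            rw [← diam_closure]
            exact dist_le_diam_of_mem' hUc hω hω'
        _ = C * ediam U ^ (s : ℝ) := by
            rw [ENNReal.ofReal_mul hCpos.le, ← ENNReal.ofReal_rpow_of_nonneg diam_nonneg
              s.coe_nonneg, diam, ENNReal.ofReal_toReal hUt]
    rw [Measure.smul_apply, smul_eq_mul]
    calc C⁻¹ * (codeMeasure M).map π U ≤ C⁻¹ * (C * ediam U ^ (s : ℝ)) := by gcongr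
      _ = ediam U ^ (s : ℝ) := by rw [← mul_assoc, ENNReal.inv_mul_cancel hC0 hCt, one_mul]
  apply le_dimH_of_hausdorffMeasure_ne_zero
  have hone : 1 ≤ (codeMeasure M).map π E := by
    have hpre : π ⁻¹' E = univ := eq_univ_of_forall fun ω =>
      hE (π ω) (treeCenter child x₀ ω) rfl (fun n => ⟨ω n, rfl⟩) (hπρ ω)
    have := Measure.le_map_apply (μ := codeMeasure M) hmeas.aemeasurable E
    rwa [hpre, measure_univ] at this
  have hpos : 0 < (C⁻¹ • (codeMeasure M).map π) E := by
    rw [Measure.smul_apply, smul_eq_mul]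
    exact ENNReal.mul_pos (ENNReal.inv_ne_zero.2 hCt) (one_pos.trans_le hone).ne'
  exact (hpos.trans_le (hle E)).ne'

end Tree

/-! ### Lower bound for the Hausdorff dimension -/

/-- The difference has numerator pq' - p'q, a nonzero Gaussian integer, hence of modulus at least 1.
-/
theorem one_div_sq_le_dist_gaussianRat {p q p' q' : GaussianInt} {Q : ℝ} (hq : q ≠ 0)
    (hq' : q' ≠ 0) (hQ : ‖(q : ℂ)‖ ≤ Q) (hQ' : ‖(q' : ℂ)‖ ≤ Q) (hne : (p : ℂ) / q ≠ p' / q') :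
    1 / Q ^ 2 ≤ dist ((p : ℂ) / q) (p' / q') := by
  have hqc : (q : ℂ) ≠ 0 := by simpa using hq
  have hqc' : (q' : ℂ) ≠ 0 := by simpa using hq'
  have h1 := GaussianInt.one_le_norm_toComplex hq
  have h1' := GaussianInt.one_le_norm_toComplex hq'
  have hnum : p * q' - p' * q ≠ 0 := by
    intro h
    apply hne
    rw [div_eq_div_iff hqc hqc', ← GaussianInt.toComplex_mul, ← GaussianInt.toComplex_mul,
      sub_eq_zero.1 h]
  have h2 : (p : ℂ) / q - p' / q' = ((p * q' - p' * q : GaussianInt) : ℂ) / (q * q') := by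
    rw [GaussianInt.toComplex_sub, GaussianInt.toComplex_mul, GaussianInt.toComplex_mul]
    field_simp
  rw [dist_eq_norm, h2, norm_div, norm_mul, pow_two]
  have h3 := GaussianInt.one_le_norm_toComplex hnum
  have hQ0 : 0 ≤ Q := by linarith
  gcongr

/-- Among finitely many pairs a nearest fraction exists. If its distance to z is positive, half that
distance gives a contradiction; if z = p/q, the multiples (kp, kq) are infinitely many pairs, as
pairs need not be coprime. -/
theorem infinite_setOf_approximating {ψ : ℝ → ℝ} (hpos : ∀ x, 0 < x → 0 < ψ x) {z : ℂ}
    (h : ∀ ε > 0, ∃ p q : GaussianInt, q ≠ 0 ∧ ‖z - (p : ℂ) / q‖ ≤ ψ ‖(q : ℂ)‖ ∧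
      ‖z - (p : ℂ) / q‖ ≤ ε) :
    {pq : GaussianInt × GaussianInt | pq.2 ≠ 0 ∧
      ‖z - (pq.1 : ℂ) / (pq.2 : ℂ)‖ ≤ ψ ‖(pq.2 : ℂ)‖}.Infinite := by
  intro hfin
  obtain ⟨p₀, q₀, hq₀, hψ₀, -⟩ := h 1 one_pos
  obtain ⟨⟨p, q⟩, ⟨hq, hψ⟩, hmin⟩ := exists_min_image _
    (fun pq : GaussianInt × GaussianInt => ‖z - (pq.1 : ℂ) / (pq.2 : ℂ)‖) hfin ⟨(p₀, q₀), hq₀, hψ₀⟩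
  simp only at hq hψ hmin
  have hqc : (q : ℂ) ≠ 0 := by simpa using hq
  rcases (norm_nonneg (z - (p : ℂ) / q)).eq_or_lt with h0 | h0
  · have hz : z = p / q := sub_eq_zero.1 (norm_eq_zero.1 h0.symm)
    refine infinite_of_injective_forall_mem
      (f := fun k : ℕ => (((k + 1 : ℕ) : GaussianInt) * p, ((k + 1 : ℕ) : GaussianInt) * q))
      (fun k k' hk => ?_) (fun k => ?_) hfin
    · have h1 := mul_right_cancel₀ hq (congrArg Prod.snd hk)
      have h2 : k + 1 = k' + 1 := Nat.cast_injective h1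
      omega
    · have hk : ((k + 1 : ℕ) : GaussianInt) ≠ 0 := Nat.cast_ne_zero.2 k.succ_ne_zero
      have hkc : (((k + 1 : ℕ) : GaussianInt) : ℂ) ≠ 0 := by
        rwa [Ne, GaussianInt.toComplex_eq_zero]
      have hne : ((k + 1 : ℕ) : GaussianInt) * q ≠ 0 := mul_ne_zero hk hq
      refine ⟨hne, ?_⟩
      simp only
      rw [GaussianInt.toComplex_mul, GaussianInt.toComplex_mul, mul_div_mul_left _ _ hkc, ← hz,
        sub_self, norm_zero]
      exact (hpos _ (norm_pos_iff.2 (mul_ne_zero hkc hqc))).le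
  · obtain ⟨p₁, q₁, hq₁, hψ₁, hle⟩ := h _ (half_pos h0)
    have := hmin (p₁, q₁) ⟨hq₁, hψ₁⟩
    simp only at this
    linarith

/-- One generation of the tree: discs of radius `Q⁻ˡ` about Gaussian rationals of denominator at
most `Q`, inside discs of radius `ρ`. -/
theorem exists_generation {S : Set ℝ} (hS : ∃ᶠ Q in atTop, Q ∈ S) {l s : ℝ} (hl : 2 < l)
    (hls : l * s < 4) {ρ N : ℝ} (hρ : 0 < ρ) (hρ1 : ρ ≤ 1) (hN : 0 < N) (κ : ℝ) :
    ∃ (Q : ℝ) (M : ℕ) (child : ℂ → Fin M → ℂ), Q ∈ S ∧ 1 ≤ Q ∧ 2 ≤ M ∧ Q ^ (-l) ≤ ρ / 2 ∧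
      4 * Q ^ (-l) ≤ 1 / Q ^ 2 ∧ ρ ^ 2 ≤ 4 * 10 ^ 8 * M * (1 / Q ^ 2) ^ 2 ∧
      κ ≤ N * M * (Q ^ (-l)) ^ s ∧
      (∀ x j, dist (child x j) x ≤ ρ / 2) ∧
      (∀ x i j, i ≠ j → 1 / Q ^ 2 ≤ dist (child x i) (child x j)) ∧
      ∀ x j, ∃ p q : GaussianInt, q ≠ 0 ∧ ‖(q : ℂ)‖ ≤ Q ∧ child x j = (p : ℂ) / q := by
  -- Each requirement holds for all large Q: `e2` uses l > 2 and separates the new discs, `e5` uses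
  -- ls < 4 and absorbs `N` and ρ. The factor 4 · 10⁸ is the counting constant 10⁸ at radius ρ/2.
  have e1 : ∀ᶠ Q : ℝ in atTop, Q ^ (-l) ≤ ρ / 2 :=
    (tendsto_rpow_neg_atTop (by linarith)).eventually_le_const (by positivity)
  have e2 : ∀ᶠ Q : ℝ in atTop, 4 ≤ Q ^ (l - 2) :=
    (tendsto_rpow_atTop (by linarith)).eventually_ge_atTop 4
  have e3 : ∀ᶠ Q : ℝ in atTop, 300 ≤ (ρ / 2) ^ 2 * Q :=
    (tendsto_id.const_mul_atTop (by positivity)).eventually_ge_atTop 300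
  have e4 : ∀ᶠ Q : ℝ in atTop, 2 ≤ ρ ^ 2 / (4 * 10 ^ 8) * Q ^ 4 :=
    ((tendsto_pow_atTop (by norm_num)).const_mul_atTop (by positivity)).eventually_ge_atTop 2
  have e5 : ∀ᶠ Q : ℝ in atTop, κ ≤ N * (ρ ^ 2 / (4 * 10 ^ 8)) * Q ^ (4 - l * s) :=
    ((tendsto_rpow_atTop (by linarith)).const_mul_atTop (by positivity)).eventually_ge_atTop κ
  obtain ⟨Q, hQS, hQ1, h1, h2, h3, h4, h5⟩ := (hS.and_eventually ((eventually_ge_atTop 1).and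
    (e1.and (e2.and (e3.and (e4.and e5)))))).exists
  have hQ0 : 0 < Q := by linarith
  set M : ℕ := ⌈ρ ^ 2 / (4 * 10 ^ 8) * Q ^ 4⌉₊ with hM
  have hMle : ρ ^ 2 / (4 * 10 ^ 8) * Q ^ 4 ≤ M := Nat.le_ceil _
  have hex (x : ℂ) := exists_finset_gaussianRat (half_pos hρ) (by linarith) h3 x
  choose T hT hTcard using hex
  have hMT (x : ℂ) : M ≤ (T x).card := by
    rw [hM, Nat.ceil_le]
    have := hTcard x
    linarith
  let child : ℂ → Fin M → ℂ := fun x j => ((T x).equivFin.symm (Fin.castLE (hMT x) j) : ℂ)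
  have hmem (x : ℂ) (j : Fin M) : child x j ∈ T x := Subtype.coe_prop _
  have hinj (x : ℂ) : Function.Injective (child x) :=
    Subtype.val_injective.comp ((T x).equivFin.symm.injective.comp (Fin.castLE_injective (hMT x)))
  refine ⟨Q, M, child, hQS, hQ1, ?_, h1, ?_, ?_, ?_, fun x j => (hT x _ (hmem x j)).1, ?_,
    fun x j => (hT x _ (hmem x j)).2⟩
  · have : (2 : ℝ) ≤ M := h4.trans hMle
    exact_mod_cast this
  · have h6 : Q ^ (l - 2) = Q ^ l / Q ^ 2 := by
      rw [Real.rpow_sub hQ0, Real.rpow_two]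
    rw [Real.rpow_neg hQ0.le, ← div_eq_mul_inv, div_le_div_iff₀ (by positivity) (by positivity)]
    rw [h6, le_div_iff₀ (by positivity)] at h2
    linarith
  · have h6 : 4 * 10 ^ 8 * (M : ℝ) * (1 / Q ^ 2) ^ 2 = 4 * 10 ^ 8 * M / Q ^ 4 := by
      field_simp
    rw [h6, le_div_iff₀ (by positivity)]
    linarith
  · have h6 : Q ^ (4 - l * s) = Q ^ 4 * (Q ^ (-l)) ^ s := by
      rw [← Real.rpow_mul hQ0.le, sub_eq_add_neg, Real.rpow_add hQ0, neg_mul]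
      norm_num
    rw [h6] at h5
    have h7 : 0 ≤ (Q ^ (-l)) ^ s := by positivity
    calc κ ≤ N * (ρ ^ 2 / (4 * 10 ^ 8)) * (Q ^ 4 * (Q ^ (-l)) ^ s) := h5
      _ = N * (ρ ^ 2 / (4 * 10 ^ 8) * Q ^ 4) * (Q ^ (-l)) ^ s := by ring
      _ ≤ _ := by gcongr
  · intro x i j hij
    obtain ⟨p, q, hq, hqQ, hpq⟩ := (hT x _ (hmem x i)).2
    obtain ⟨p', q', hq', hqQ', hpq'⟩ := (hT x _ (hmem x j)).2
    have hne := (hinj x).ne hij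
    rw [hpq, hpq'] at hne ⊢
    exact one_div_sq_le_dist_gaussianRat hq hq' hqQ hqQ' hne

theorem le_dimH_approximableSet_of_frequently {ψ : ℝ → ℝ} (hpos : ∀ x, 0 < x → 0 < ψ x)
    (hanti : AntitoneOn ψ (Ioi 0)) {l : ℝ} {s : ℝ≥0} (hl : 2 < l) (hls : l * s < 4) (hs : s ≤ 2)
    (hψ : ∃ᶠ x in atTop, x ^ (-l) ≤ ψ x) : (s : ℝ≥0∞) ≤ dimH (approximableSet ψ) := by
  set κ : ℝ := (1 / 8 : ℝ) ^ (s : ℝ) with hκ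
  -- A state is the radius of the current discs and their number; these determine the next Q. The
  -- root (1/8, 1) makes κ the value of Nρˢ at generation 0.
  let State := {a : ℝ × ℝ // 0 < a.1 ∧ a.1 ≤ 1 ∧ 0 < a.2}
  choose Q M child hQS hQ1 hM hρ2 hδρ hcount hmass hchild hsep hrat using fun a : State =>
    exists_generation (S := {x | x ^ (-l) ≤ ψ x}) hψ hl hls a.2.1 a.2.2.1 a.2.2.2 κ
  have hnext (a : State) : 0 < Q a ^ (-l) ∧ Q a ^ (-l) ≤ 1 ∧ 0 < a.1.2 * M a := by
    have h1 := hQ1 a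
    have h2 : (0 : ℝ) < M a := by exact_mod_cast two_pos.trans_le (hM a)
    exact ⟨by positivity, Real.rpow_le_one_of_one_le_of_nonpos h1 (by linarith),
      mul_pos a.2.2.2 h2⟩
  let st : ℕ → State := fun n => Nat.rec ⟨(1 / 8, 1), by norm_num⟩
    (fun _ a => ⟨(Q a ^ (-l), a.1.2 * M a), hnext a⟩) n
  have hprod (n : ℕ) : ∏ i ∈ Finset.range n, (M (st i) : ℝ) = (st n).1.2 := by
    induction n with
    | zero => simp [st]
    | succ n ih => rw [Finset.prod_range_succ, ih]
  refine le_dimH_of_tree (M := fun n => M (st n)) (child := fun n => child (st n)) (x₀ := 1 / 4)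
    (ρ := fun n => (st n).1.1) (δ := fun n => 1 / Q (st n) ^ 2) (K := 4 * 10 ^ 8) (κ := κ)
    (fun n => hM _) (fun n => (st n).2.1) (fun n => hρ2 (st n)) (fun n => hchild (st n))
    (fun n => by have := hQ1 (st n); positivity) (fun n => hδρ (st n)) (fun n => hsep (st n))
    hs (by norm_num) (fun n => hcount (st n)) (by positivity) ?_ ?_
  · intro n
    rw [hprod]
    cases n with
    | zero => simp [st, hκ]
    | succ n => exact hmass (st n)
  · intro z w hw0 hw hz
    refine ⟨closedBall_subset_hurwitzDomain ?_, infinite_setOf_approximating hpos fun ε hε => ?_⟩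
    · have := hz 0
      rwa [hw0] at this
    · obtain ⟨n, hn⟩ := exists_pow_lt_of_lt_one hε (show (1 / 2 : ℝ) < 1 by norm_num)
      obtain ⟨j, hj⟩ := hw n
      obtain ⟨p, q, hq, hqQ, hpq⟩ := hrat (st n) (w n) j
      have hd := hz (n + 1)
      rw [hj, hpq, dist_eq_norm] at hd
      have hq1 := GaussianInt.one_le_norm_toComplex hq
      refine ⟨p, q, hq, ?_, ?_⟩
      · calc ‖z - (p : ℂ) / q‖ ≤ Q (st n) ^ (-l) := hd
          _ ≤ ψ (Q (st n)) := hQS (st n)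
          _ ≤ ψ ‖(q : ℂ)‖ := hanti (mem_Ioi.2 (by linarith)) (mem_Ioi.2 (by linarith)) hqQ
      · have hgeom := le_div_two_pow_of_halving (ρ := fun n => (st n).1.1)
          (fun n => hρ2 (st n)) n
        have h0 : (st 0).1.1 = 1 / 8 := rfl
        have hhalf := hρ2 (st n)
        have hstpos := (st n).2.1
        calc ‖z - (p : ℂ) / q‖ ≤ Q (st n) ^ (-l) := hd
          _ ≤ (st n).1.1 := by linarith
          _ ≤ (1 / 8) / 2 ^ n := hgeom
          _ ≤ (1 / 2) ^ n := by
              rw [one_div_pow]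
              gcongr
              norm_num
          _ ≤ ε := hn.le

/-- For 0 < s < min(4/λ, 2) one has max(λ, 2) < 4/s, which leaves room for l; exceeding the liminf,
l is an exponent that ψ beats for arbitrarily large x. -/
theorem le_dimH_approximableSet {ψ : ℝ → ℝ} (hpos : ∀ x, 0 < x → 0 < ψ x)
    (hanti : AntitoneOn ψ (Ioi 0)) :
    min (4 / (lowerOrder ψ).toENNReal) 2 ≤ dimH (approximableSet ψ) := by
  refine le_of_forall_lt fun c hc => ?_
  obtain ⟨s, hcs, hs⟩ := ENNReal.lt_iff_exists_nnreal_btwn.1 hc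
  refine hcs.trans_le ?_
  obtain ⟨hs4, hs2⟩ := lt_min_iff.1 hs
  have hs2' : s < 2 := by exact_mod_cast hs2
  have hs0 : 0 < s := by
    have := (zero_le (a := c)).trans_lt hcs
    exact_mod_cast this
  have hs0' : (0 : ℝ) < s := hs0
  have hs2r : (s : ℝ) < 2 := by exact_mod_cast hs2'
  have hlt : max (lowerOrder ψ) ((2 : ℝ) : EReal) < ((4 / s : ℝ) : EReal) := by
    refine max_lt ?_ ?_
    · have h1 : (lowerOrder ψ).toENNReal < 4 / (s : ℝ≥0∞) := by
        rw [ENNReal.lt_div_iff_mul_lt (by simp [hs0.ne']) (by simp [hs0.ne'])] at hs4 ⊢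
        rwa [mul_comm]
      by_contra! h
      have h2 := EReal.toENNReal_le_toENNReal h
      rw [EReal.real_coe_toENNReal, ENNReal.ofReal_div_of_pos hs0', ENNReal.ofReal_coe_nnreal,
        ENNReal.ofReal_ofNat] at h2
      exact h2.not_gt h1
    · have h1 : (2 : ℝ) < 4 / s := by
        rw [lt_div_iff₀ hs0']; linarith
      exact EReal.coe_lt_coe_iff.2 h1
  obtain ⟨l, hl1, hl2⟩ := EReal.lt_iff_exists_real_btwn.1 hlt
  have hl : (2 : ℝ) < l :=
    EReal.coe_lt_coe_iff.1 ((le_max_right _ _).trans_lt hl1)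
  have hls : l * s < 4 := by
    have : l < 4 / s := by exact_mod_cast hl2
    rwa [lt_div_iff₀ hs0'] at this
  refine le_dimH_approximableSet_of_frequently hpos hanti hl hls hs2'.le ?_
  refine ((frequently_lt_of_liminf_lt (by isBoundedDefault)
    ((le_max_left _ _).trans_lt hl1)).and_eventually (eventually_gt_atTop 1)).mono ?_
  rintro x ⟨hx, hx1⟩
  have hx2 : -Real.log (ψ x) / Real.log x < l := by exact_mod_cast hx
  rw [div_lt_iff₀ (Real.log_pos hx1)] at hx2
  rw [← Real.log_le_log_iff (by positivity) (hpos x (by linarith)), Real.log_rpow (by linarith)]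
  linarith

theorem dimH_le_two (E : Set ℂ) : dimH E ≤ 2 := by
  have h := dimH_mono (subset_univ E)
  rw [Real.dimH_univ_eq_finrank, Complex.finrank_real_complex] at h
  exact_mod_cast h

/-- In `ℝ≥0∞`, `4 / 0 = ∞` and `4 / ∞ = 0`. -/
theorem theorem2 (ψ : ℝ → ℝ) (hpos : ∀ x, 0 < x → 0 < ψ x)
    (hanti : AntitoneOn ψ (Set.Ioi 0)) (hlim : Tendsto ψ atTop (𝓝 0)) :
    dimH (approximableSet ψ) = min (4 / (lowerOrder ψ).toENNReal) 2 ∧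
      packingDim (approximableSet ψ) = 2 :=
  ⟨le_antisymm (le_min (dimH_approximableSet_le hpos hanti) (dimH_le_two _))
    (le_dimH_approximableSet hpos hanti), packingDim_approximableSet hpos⟩
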